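/- Notation. For $n\ge 1$ let $S(2n)$ be the group of permutations of $\{-n,\dots,-1,1,\dots,n\}$, with permutations multiplied from left to right; $S(2n)$ is identified with the subgroup of $S(2n+2)$ fixing $\pm(n+1)$, and $S(2\infty)=\bigcup_{n\ge1}S(2n)$. Let $X(n)$ be the finite set of all pairings of $\{-n,\dots,-1,1,\dots,n\}$ into $n$ unordered pairs, on which $S(2n)$ acts from the right by $\{i,j\}\mapsto\{g(i),g(j)\}$ on pairs. $X(n)$ is regarded as a subset of $X(n+1)$ by adding the pair $\{-n-1,n+1\}$. The canonical projection $p_{n,n+1}:X(n+1)\to X(n)$ deletes the pair $\{-n-1,n+1\}$ if it is present, and otherwise replaces the pairs $\{i,-n-1\}$, $\{k,n+1\}$ by $\{i,k\}$. For $x\in X(n)$ let $[x]_n$ be the number of cycles of $x$, that is, the number of classes of the equivalence relation on $\{-n,\dots,-1,1,\dots,n\}$ generated by $i\sim-i$ and by $i\sim j$ for the pairs $\{i,j\}$ of $x$. Let $X=\varprojlim X(n)$ along the maps $p_{n,n+1}$, with projections $p_n:X\to X(n)$ and with the right action of $S(2\infty)$ given by $p_n(x\cdot g)=p_n(x)\cdot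 g$ for all $n$ with $g\in S(2n)$. For $x\in X$ and $g\in S(2\infty)$ put $c(x;g)=[p_n(x)\cdot g]_n-[p_n(x)]_n$ for any $n$ with $g\in S(2n)$ (this does not depend on $n$). For $t>0$ let $\mu_t^{(n)}$ be the probability measure on $X(n)$ with $\mu_t^{(n)}(x)=\dfrac{t^{[x]_n}}{t(t+2)\cdots(t+2n-2)}$, and let $\mu_t=\varprojlim\mu_t^{(n)}$ be the corresponding probability measure on $X$. In particular $\mu_1^{(n)}$ is the uniform probability measure on $X(n)$. Let $z$ be a nonzero complex number and $t=|z|^2$. Let $T_{z,1/2}$ be the unitary representation of $S(2\infty)$ in $L^2(X,\mu_t)$ given by $(T_{z,1/2}(g)f)(x)=z^{c(x;g)}f(x\cdot g)$. For $n\ge1$ let $Reg^n$ be the unitary representation of $S(2n)$ in $L^2(X(n),\mu_1^{(n)})$ given by $(Reg^n(g)f)(x)=f(x\cdot g)$, and define the linear operator $L_z^{(n)}:L^2(X(n),\mu_1^{(n)})\to L^2(X(n+1),\mu_1^{(n+1)})$ by $$(L_z^{(n)}f)(x)=\begin{cases} z\sqrt{\frac{2n+1}{2n+t}}\,f(x),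 & x\in X(n)\subset X(n+1),\\[4pt] \sqrt{\frac{2n+1}{2n+t}}\,f(p_{n,n+1}(x)), & x\in X(n+1)\setminus X(n).\end{cases}$$ Proposition. For every $n\ge 1$ the operator $L_z^{(n)}$ is an isometric embedding, and it intertwines the representations $Reg^n$ and $Reg^{n+1}|_{S(2n)}$ of $S(2n)$. Let $T'_{z,1/2}$ be the inductive limit of the representations $Reg^n$ along the embeddings $L_z^{(n)}$, that is, the unitary representation of $S(2\infty)$ in the Hilbert completion $H$ of $\bigcup_{n\ge1}L^2(X(n),\mu_1^{(n)})$ (the union along the embeddings $L_z^{(n)}$) which is determined by $T'_{z,1/2}(g)\xi=Reg^n(g)\xi$ for $g\in S(2n)$ and $\xi\in L^2(X(n),\mu_1^{(n)})$. Then the representations $T'_{z,1/2}$ and $T_{z,1/2}$ of $S(2\infty)$ are (unitarily) equivalent. -/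

import Mathlib

open MeasureTheory
open scoped ENNReal InnerProductSpace

noncomputable section

/-! ### Unitary representations and their inductive limits -/

/-- A unitary representation of the group `G` in the Hilbert space `H`: a homomorphism from `G` to
the group of surjective linear isometries of `H`. -/
abbrev UnitaryRep (G : Type) [Group G] (H : Type) [NormedAddCommGroup H]
    [InnerProductSpace ℂ H] : Type :=
  G →* (H ≃ₗᵢ[ℂ] H)

namespace UnitaryRep

variable {G : Type} [Group G]

/-- (Unitary) equivalence of unitary representations. -/
def Equivalent {H K : Type} [NormedAddCommGroup H] [InnerProductSpace ℂ H]
    [NormedAddCommGroup K] [InnerProductSpace ℂ K]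
    (T : UnitaryRep G H) (S : UnitaryRep G K) : Prop :=
  ∃ U : H ≃ₗᵢ[ℂ] K, ∀ (g : G) (ξ : H), U (T g ξ) = S g (U ξ)

/-- A multiplicative family of linear isometries of `H` with `T 1 = 1` is a unitary
representation. -/
def ofIsometries {H : Type} [NormedAddCommGroup H] [InnerProductSpace ℂ H]
    (T : G → H →ₗᵢ[ℂ] H) (h_one : ∀ ξ, T 1 ξ = ξ)
    (h_mul : ∀ g₁ g₂ ξ, T (g₁ * g₂) ξ = T g₁ (T g₂ ξ)) : UnitaryRep G H where
  toFun g :=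
    { toLinearEquiv := LinearEquiv.ofLinearMap (T g).toLinearMap (T g⁻¹).toLinearMap
        (by ext ξ; simp [← h_mul, h_one]) (by ext ξ; simp [← h_mul, h_one])
      norm_map' := (T g).norm_map }
  map_one' := by ext ξ; exact h_one ξ
  map_mul' g₁ g₂ := by ext ξ; exact h_mul g₁ g₂ ξ

@[simp] theorem ofIsometries_apply {H : Type} [NormedAddCommGroup H] [InnerProductSpace ℂ H]
    (T : G → H →ₗᵢ[ℂ] H) (h_one : ∀ ξ, T 1 ξ = ξ)
    (h_mul : ∀ g₁ g₂ ξ, T (g₁ * g₂) ξ = T g₁ (T g₂ ξ)) (g : G) (ξ : H) :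
    ofIsometries T h_one h_mul g ξ = T g ξ := rfl

end UnitaryRep

namespace IndLim

variable {H : ℕ → Type} [∀ n, NormedAddCommGroup (H n)] [∀ n, InnerProductSpace ℂ (H n)]

/-- The composite embedding `H m → H n` of a chain of isometric embeddings, for `m ≤ n`. -/
def trans (α : ∀ n, H n →ₗᵢ[ℂ] H (n + 1)) (m n : ℕ) (h : m ≤ n) : H m →ₗᵢ[ℂ] H n :=
  Nat.leRec (motive := fun k _ => H m →ₗᵢ[ℂ] H k) LinearIsometry.id
    (fun k _ F => (α k).comp F) h

theorem trans_self (α : ∀ n, H n →ₗᵢ[ℂ] H (n + 1)) (m : ℕ) (ξ : H m) :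
    trans α m m le_rfl ξ = ξ := by
  simp [trans, Nat.leRec_self]

theorem trans_succ (α : ∀ n, H n →ₗᵢ[ℂ] H (n + 1)) (m n : ℕ) (h : m ≤ n) (ξ : H m) :
    trans α m (n + 1) (h.trans n.le_succ) ξ = α n (trans α m n h ξ) := by
  simp [trans, Nat.leRec_succ _ _ h]

theorem trans_trans (α : ∀ n, H n →ₗᵢ[ℂ] H (n + 1)) {k m n : ℕ} (h₁ : k ≤ m) (h₂ : m ≤ n)
    (ξ : H k) : trans α m n h₂ (trans α k m h₁ ξ) = trans α k n (h₁.trans h₂) ξ := by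
  induction n, h₂ using Nat.le_induction with
  | base => rw [trans_self]
  | succ n h ih => rw [trans_succ α m n h, ih, ← trans_succ α k n (h₁.trans h)]

instance directedSystem (α : ∀ n, H n →ₗᵢ[ℂ] H (n + 1)) :
    DirectedSystem H (fun _ _ h => trans α _ _ h) where
  map_self _ x := trans_self α _ x
  map_map _ _ _ h₁ h₂ x := trans_trans α h₁ h₂ x

/-- The union `⋃ₙ H n` along the embeddings `α`: the direct limit of vector spaces. -/
def UnionSpace (α : ∀ n, H n →ₗᵢ[ℂ] H (n + 1)) : Type :=
  DirectLimit H (fun i j h => trans α i j h)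

variable (α : ∀ n, H n →ₗᵢ[ℂ] H (n + 1))

instance : AddCommGroup (UnionSpace α) :=
  inferInstanceAs (AddCommGroup (DirectLimit H (fun i j h => trans α i j h)))

instance : Module ℂ (UnionSpace α) :=
  inferInstanceAs (Module ℂ (DirectLimit H (fun i j h => trans α i j h)))

/-- The inclusion of `H n` in the union. -/
def incl (n : ℕ) : H n →ₗ[ℂ] UnionSpace α where
  toFun ξ := (⟦⟨n, ξ⟩⟧ : DirectLimit H (fun i j h => trans α i j h))
  map_add' x y := (DirectLimit.add_def (f := fun i j h => trans α i j h) n x y).symm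
  map_smul' c x := (DirectLimit.smul_def (f := fun i j h => trans α i j h) n x c).symm

theorem incl_trans {m n : ℕ} (h : m ≤ n) (ξ : H m) : incl α n (trans α m n h ξ) = incl α m ξ :=
  DirectLimit.mk_apply (f := fun i j h => trans α i j h) m n ξ h

theorem exists_incl (x : UnionSpace α) : ∃ n ξ, x = incl α n ξ :=
  DirectLimit.exists_eq_mk (fun i j h => trans α i j h) x

theorem exists_incl₂ (x y : UnionSpace α) : ∃ n ξ η, x = incl α n ξ ∧ y = incl α n η :=
  DirectLimit.exists_eq_mk₂ (fun i j h => trans α i j h) x y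

/-- The inner product of the union, which extends the inner products of all the `H n`. -/
instance : Inner ℂ (UnionSpace α) where
  inner := DirectLimit.lift₂ (fun i j h => trans α i j h) (fun i j h => trans α i j h)
    (fun _ ξ η => ⟪ξ, η⟫_ℂ) (fun i j h ξ η => ((trans α i j h).inner_map_map ξ η).symm)

theorem inner_incl (n : ℕ) (ξ η : H n) : ⟪incl α n ξ, incl α n η⟫_ℂ = ⟪ξ, η⟫_ℂ :=
  DirectLimit.lift₂_def (fun i j h => trans α i j h) (fun i j h => trans α i j h) _ _ n ξ η

/-- The pre-Hilbert space structure of the union. -/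
abbrev core : InnerProductSpace.Core ℂ (UnionSpace α) where
  conj_inner_symm x y := by
    obtain ⟨n, ξ, η, rfl, rfl⟩ := exists_incl₂ α x y
    simp only [inner_incl]; exact inner_conj_symm ξ η
  re_inner_nonneg x := by
    obtain ⟨n, ξ, rfl⟩ := exists_incl α x
    rw [inner_incl]; exact inner_self_nonneg
  add_left x y w := by
    obtain ⟨n, ξ, η, rfl, rfl⟩ := exists_incl₂ α x y
    obtain ⟨m, ζ, rfl⟩ := exists_incl α w
    rw [← incl_trans α (le_max_left n m), ← incl_trans α (le_max_left n m) η,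
      ← incl_trans α (le_max_right n m), ← map_add]
    simp only [inner_incl, inner_add_left]
  smul_left x y c := by
    obtain ⟨n, ξ, η, rfl, rfl⟩ := exists_incl₂ α x y
    rw [← map_smul, inner_incl, inner_incl, inner_smul_left]
  definite x hx := by
    obtain ⟨n, ξ, rfl⟩ := exists_incl α x
    rw [inner_incl, inner_self_eq_zero] at hx
    rw [hx, map_zero]

instance : NormedAddCommGroup (UnionSpace α) := (core α).toNormedAddCommGroup

instance : InnerProductSpace ℂ (UnionSpace α) := InnerProductSpace.ofCore (core α).toCore

theorem norm_incl (n : ℕ) (ξ : H n) : ‖incl α n ξ‖ = ‖ξ‖ := by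
  rw [@norm_eq_sqrt_re_inner ℂ, @norm_eq_sqrt_re_inner ℂ _ _ _ _ ξ, inner_incl]

/-- The inductive limit of Hilbert spaces: the Hilbert completion of the union. -/
abbrev Space : Type := UniformSpace.Completion (UnionSpace α)

/-- The isometric embedding of `H n` in the inductive limit. -/
def embed (n : ℕ) : H n →ₗᵢ[ℂ] Space α :=
  (UniformSpace.Completion.toComplₗᵢ (𝕜 := ℂ) (E := UnionSpace α)).comp ⟨incl α n, norm_incl α n⟩

theorem embed_trans {m n : ℕ} (h : m ≤ n) (ξ : H m) :
    embed α n (trans α m n h ξ) = embed α m ξ :=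
  congrArg (fun x : UnionSpace α => (x : Space α)) (incl_trans α h ξ)

theorem dense_embed : Dense {x : Space α | ∃ n ξ, x = embed α n ξ} := by
  refine (UniformSpace.Completion.denseRange_coe (α := UnionSpace α)).mono ?_
  rintro _ ⟨x, rfl⟩
  obtain ⟨n, ξ, rfl⟩ := exists_incl α x
  exact ⟨n, ξ, rfl⟩

/-- Two bounded operators on the limit that agree on all the `H n` are equal. -/
theorem ext_embed {F F' : Space α →ₗᵢ[ℂ] Space α}
    (h : ∀ n ξ, F (embed α n ξ) = F' (embed α n ξ)) (x : Space α) : F x = F' x := by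
  refine congrFun (Continuous.ext_on (dense_embed α) F.continuous F'.continuous ?_) x
  rintro _ ⟨n, ξ, rfl⟩
  exact h n ξ

variable {Γ : Type} [Group Γ] {G : ℕ → Subgroup Γ} (hG : Monotone G)
  (T : ∀ n, UnitaryRep (G n) (H n))

theorem trans_intertwines
    (hT : ∀ (n : ℕ) (g : G n) (ξ : H n),
      α n (T n g ξ) = T (n + 1) (Subgroup.inclusion (hG n.le_succ) g) (α n ξ))
    {m n : ℕ} (h : m ≤ n) (g : G m) (ξ : H m) :
    trans α m n h (T m g ξ) = T n (Subgroup.inclusion (hG h) g) (trans α m n h ξ) := by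
  induction n, h using Nat.le_induction with
  | base => rw [trans_self, trans_self]; rfl
  | succ n h ih => rw [trans_succ α m n h, ih, hT, trans_succ α m n h]; rfl

theorem exists_stage (hG : Monotone G) (g : (⨆ n, G n : Subgroup Γ)) : ∃ n, (g : Γ) ∈ G n :=
  (Subgroup.mem_iSup_of_directed hG.directed_le).1 g.2

/-- The operator of the inductive limit representation on the union. -/
theorem exists_unionMap
    (hT : ∀ (n : ℕ) (g : G n) (ξ : H n),
      α n (T n g ξ) = T (n + 1) (Subgroup.inclusion (hG n.le_succ) g) (α n ξ))
    (g : (⨆ n, G n : Subgroup Γ)) :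
    ∃ F : UnionSpace α →ₗᵢ[ℂ] UnionSpace α,
      ∀ (n : ℕ) (h : (g : Γ) ∈ G n) (ξ : H n), F (incl α n ξ) = incl α n (T n ⟨g, h⟩ ξ) := by
  obtain ⟨N, hN⟩ := exists_stage hG g
  have hm : ∀ n, (g : Γ) ∈ G (max n N) := fun n => hG (le_max_right n N) hN
  let φ : ∀ n, H n → UnionSpace α := fun n ξ =>
    incl α (max n N) (T (max n N) ⟨g, hm n⟩ (trans α n (max n N) (le_max_left n N) ξ))
  have key : ∀ (n k : ℕ) (hk : n ≤ k) (h : (g : Γ) ∈ G k) (ξ : H n),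
      φ n ξ = incl α k (T k ⟨g, h⟩ (trans α n k hk ξ)) := by
    intro n k hk h ξ
    have hle₁ : max n N ≤ max k N := max_le_max hk le_rfl
    have hle₂ : k ≤ max k N := le_max_left _ _
    simp only [φ]
    rw [← incl_trans α hle₁, ← incl_trans α hle₂ (T k _ _), trans_intertwines α hG T hT hle₁,
      trans_intertwines α hG T hT hle₂, trans_trans, trans_trans]
    rfl
  let F : UnionSpace α → UnionSpace α := DirectLimit.lift (fun i j h => trans α i j h) φ (by
    intro i j h ξ
    rw [key i (max j N) (h.trans (le_max_left _ _)) (hm j), ← trans_trans α h (le_max_left j N)])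
  have hF : ∀ n ξ, F (incl α n ξ) = φ n ξ := fun n ξ => rfl
  have hF' : ∀ (n : ℕ) (h : (g : Γ) ∈ G n) (ξ : H n),
      F (incl α n ξ) = incl α n (T n ⟨g, h⟩ ξ) := by
    intro n h ξ
    rw [hF, key n n le_rfl h, trans_self]
  have hx : ∀ x : UnionSpace α, ∃ (n : ℕ) (_ : (g : Γ) ∈ G n) (ξ : H n), x = incl α n ξ := by
    intro x
    obtain ⟨n, ξ, rfl⟩ := exists_incl α x
    exact ⟨max n N, hm n, trans α n _ (le_max_left _ _) ξ, (incl_trans α _ ξ).symm⟩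
  have hx₂ : ∀ x y : UnionSpace α, ∃ (n : ℕ) (_ : (g : Γ) ∈ G n) (ξ η : H n),
      x = incl α n ξ ∧ y = incl α n η := by
    intro x y
    obtain ⟨n, ξ, η, rfl, rfl⟩ := exists_incl₂ α x y
    exact ⟨max n N, hm n, trans α n _ (le_max_left _ _) ξ, trans α n _ (le_max_left _ _) η,
      (incl_trans α _ ξ).symm, (incl_trans α _ η).symm⟩
  refine ⟨⟨{ toFun := F, map_add' := ?_, map_smul' := ?_ }, ?_⟩, hF'⟩
  · intro x y
    obtain ⟨n, h, ξ, η, rfl, rfl⟩ := hx₂ x y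
    rw [← map_add, hF' n h, hF' n h, hF' n h, map_add, map_add]
  · intro c x
    obtain ⟨n, h, ξ, rfl⟩ := hx x
    rw [← map_smul, hF' n h, hF' n h, map_smul, map_smul, RingHom.id_apply]
  · intro x
    obtain ⟨n, h, ξ, rfl⟩ := hx x
    change ‖F (incl α n ξ)‖ = _
    rw [hF' n h, norm_incl, norm_incl, LinearIsometryEquiv.norm_map]

/-- The operators of the inductive limit exist (and are determined by the stated condition). -/
theorem exists_map
    (hT : ∀ (n : ℕ) (g : G n) (ξ : H n),
      α n (T n g ξ) = T (n + 1) (Subgroup.inclusion (hG n.le_succ) g) (α n ξ))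
    (g : (⨆ n, G n : Subgroup Γ)) :
    ∃ F : Space α →ₗᵢ[ℂ] Space α,
      ∀ (n : ℕ) (h : (g : Γ) ∈ G n) (ξ : H n), F (embed α n ξ) = embed α n (T n ⟨g, h⟩ ξ) := by
  obtain ⟨F, hF⟩ := exists_unionMap α hG T hT g
  let F₁ : UnionSpace α →L[ℂ] Space α :=
    (UniformSpace.Completion.toComplₗᵢ (𝕜 := ℂ) (E := UnionSpace α)).toContinuousLinearMap.comp
      F.toContinuousLinearMap
  let e : UnionSpace α →L[ℂ] Space α := UniformSpace.Completion.toComplL (𝕜 := ℂ) (E := UnionSpace α)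
  have hd : DenseRange e := UniformSpace.Completion.denseRange_coe
  have hu : IsUniformInducing e := UniformSpace.Completion.isUniformInducing_coe _
  have hext : ∀ x : UnionSpace α, F₁.extend e (e x) = F₁ x := fun x => F₁.extend_eq hd hu x
  refine ⟨⟨(F₁.extend e).toLinearMap, ?_⟩, ?_⟩
  · intro x
    refine UniformSpace.Completion.induction_on x ?_ ?_
    · exact isClosed_eq (F₁.extend e).continuous.norm continuous_norm
    · intro y
      change ‖F₁.extend e (e y)‖ = _
      rw [hext]
      change ‖((F y : UnionSpace α) : Space α)‖ = _
      rw [UniformSpace.Completion.norm_coe, UniformSpace.Completion.norm_coe, F.norm_map]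
  · intro n h ξ
    change F₁.extend e (e (incl α n ξ)) = _
    rw [hext]
    change ((F (incl α n ξ) : UnionSpace α) : Space α) = _
    rw [hF n h]
    rfl

/-- The inductive limit of the unitary representations `T n` of the groups `G n` along the
intertwining isometric embeddings `α n`: the unitary representation `T` of `⋃ₙ G n` in the
completion of `⋃ₙ H n` such that `T g ξ = T n g ξ` for `g ∈ G n` and `ξ ∈ H n`. -/
def rep
    (hT : ∀ (n : ℕ) (g : G n) (ξ : H n),
      α n (T n g ξ) = T (n + 1) (Subgroup.inclusion (hG n.le_succ) g) (α n ξ)) :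
    UnitaryRep (⨆ n, G n : Subgroup Γ) (Space α) :=
  UnitaryRep.ofIsometries (fun g => Classical.choose (exists_map α hG T hT g))
    (by
      refine ext_embed α (F' := LinearIsometry.id) fun n ξ => ?_
      rw [Classical.choose_spec (exists_map α hG T hT 1) n (G n).one_mem]
      have : (⟨((1 : (⨆ n, G n : Subgroup Γ)) : Γ), (G n).one_mem⟩ : G n) = 1 := rfl
      rw [this, map_one]; rfl)
    (by
      intro g₁ g₂
      refine ext_embed α (F' := (Classical.choose (exists_map α hG T hT g₁)).comp
        (Classical.choose (exists_map α hG T hT g₂))) fun n ξ => ?_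
      obtain ⟨N₁, h₁⟩ := exists_stage hG g₁
      obtain ⟨N₂, h₂⟩ := exists_stage hG g₂
      set m := max n (max N₁ N₂) with hm
      have k₁ : (g₁ : Γ) ∈ G m := hG (by omega) h₁
      have k₂ : (g₂ : Γ) ∈ G m := hG (by omega) h₂
      rw [← embed_trans α (show n ≤ m by omega) ξ]
      rw [Classical.choose_spec (exists_map α hG T hT (g₁ * g₂)) m ((G m).mul_mem k₁ k₂)]
      rw [show ∀ (A B : Space α →ₗᵢ[ℂ] Space α) x, A.comp B x = A (B x) from fun _ _ _ => rfl,
        Classical.choose_spec (exists_map α hG T hT g₂) m k₂,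
        Classical.choose_spec (exists_map α hG T hT g₁) m k₁]
      have : (⟨((g₁ * g₂ : (⨆ n, G n : Subgroup Γ)) : Γ), (G m).mul_mem k₁ k₂⟩ : G m)
          = ⟨g₁, k₁⟩ * ⟨g₂, k₂⟩ := rfl
      rw [this, map_mul]; rfl)

theorem rep_embed
    (hT : ∀ (n : ℕ) (g : G n) (ξ : H n),
      α n (T n g ξ) = T (n + 1) (Subgroup.inclusion (hG n.le_succ) g) (α n ξ))
    (g : (⨆ n, G n : Subgroup Γ)) (n : ℕ) (h : (g : Γ) ∈ G n) (ξ : H n) :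
    rep α hG T hT g (embed α n ξ) = embed α n (T n ⟨g, h⟩ ξ) :=
  Classical.choose_spec (exists_map α hG T hT g) n h ξ

end IndLim

/-! ### The representation defined by a multiplicative cocycle -/

/-- `act` is a right action of the group `G` on the measure space `(X, μ)` that preserves the
measurable structure, `τ` is a nonvanishing multiplicative cocycle, and the measure `μ` is
quasi-invariant with `dμ(x · g) = |τ(x; g)|² dμ(x)`. -/
structure IsCocycle {G X : Type} [Group G] [MeasurableSpace X] (μ : Measure X)
    (act : X → G → X) (τ : X → G → ℂ) : Prop where
  act_one : ∀ x, act x 1 = x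
  act_mul : ∀ x g₁ g₂, act x (g₁ * g₂) = act (act x g₁) g₂
  measurable_act : ∀ g, Measurable fun x => act x g
  measurable_cocycle : ∀ g, Measurable fun x => τ x g
  cocycle_ne_zero : ∀ x g, τ x g ≠ 0
  cocycle_mul : ∀ x g₁ g₂, τ x (g₁ * g₂) = τ (act x g₁) g₂ * τ x g₁
  map_eq : ∀ g, (μ.withDensity fun x => ‖τ x g‖ₑ ^ 2).map (fun x => act x g) = μ

namespace IsCocycle

variable {G X : Type} [Group G] [MeasurableSpace X] {μ : Measure X}
  {act : X → G → X} {τ : X → G → ℂ}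

theorem cocycle_one (h : IsCocycle μ act τ) (x : X) : τ x 1 = 1 := by
  have h₁ := h.cocycle_mul x 1 1
  rw [mul_one, h.act_one] at h₁
  exact (mul_eq_left₀ (h.cocycle_ne_zero x 1)).1 h₁.symm

theorem quasi (h : IsCocycle μ act τ) (g : G) :
    Measure.QuasiMeasurePreserving (fun x => act x g) μ μ := by
  refine ⟨h.measurable_act g, ?_⟩
  have hm : Measurable fun x => ‖τ x g‖ₑ ^ 2 := (h.measurable_cocycle g).enorm.pow_const 2
  have h₁ : μ ≪ μ.withDensity fun x => ‖τ x g‖ₑ ^ 2 :=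
    withDensity_absolutelyContinuous' hm.aemeasurable
      (Filter.Eventually.of_forall fun x => by simp [h.cocycle_ne_zero x g])
  have h₂ := h₁.map (h.measurable_act g)
  rwa [h.map_eq g] at h₂

theorem aestronglyMeasurable (h : IsCocycle μ act τ) (g : G) {f : X → ℂ}
    (hf : AEStronglyMeasurable f μ) :
    AEStronglyMeasurable (fun x => τ x g * f (act x g)) μ :=
  (h.measurable_cocycle g).aestronglyMeasurable.mul (hf.comp_quasiMeasurePreserving (h.quasi g))

theorem eLpNorm_eq (h : IsCocycle μ act τ) (g : G) {f : X → ℂ}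
    (hf : AEStronglyMeasurable f μ) :
    eLpNorm (fun x => τ x g * f (act x g)) 2 μ = eLpNorm f 2 μ := by
  have hm : Measurable fun x => ‖τ x g‖ₑ ^ 2 := (h.measurable_cocycle g).enorm.pow_const 2
  have hF : AEMeasurable (fun x => ‖f x‖ₑ ^ 2) μ := hf.enorm.pow_const 2
  rw [eLpNorm_eq_lintegral_rpow_enorm_toReal (by norm_num) (by norm_num),
    eLpNorm_eq_lintegral_rpow_enorm_toReal (by norm_num) (by norm_num)]
  congr 1
  simp only [ENNReal.toReal_ofNat, ENNReal.rpow_ofNat, enorm_mul, mul_pow]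
  calc ∫⁻ x, ‖τ x g‖ₑ ^ 2 * ‖f (act x g)‖ₑ ^ 2 ∂μ
      = ∫⁻ x, ‖f (act x g)‖ₑ ^ 2 ∂(μ.withDensity fun x => ‖τ x g‖ₑ ^ 2) := by
        exact (lintegral_withDensity_eq_lintegral_mul₀ hm.aemeasurable
          (hF.comp_quasiMeasurePreserving (h.quasi g))).symm
    _ = ∫⁻ y, ‖f y‖ₑ ^ 2 ∂((μ.withDensity fun x => ‖τ x g‖ₑ ^ 2).map fun x => act x g) := by
        rw [lintegral_map' (by rwa [h.map_eq g]) (h.measurable_act g).aemeasurable]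
    _ = ∫⁻ y, ‖f y‖ₑ ^ 2 ∂μ := by rw [h.map_eq g]

theorem memLp (h : IsCocycle μ act τ) (g : G) (f : Lp ℂ 2 μ) :
    MemLp (fun x => τ x g * f (act x g)) 2 μ :=
  ⟨h.aestronglyMeasurable g (Lp.aestronglyMeasurable f), by
    rw [h.eLpNorm_eq g (Lp.aestronglyMeasurable f)]; exact Lp.eLpNorm_lt_top f⟩

/-- The operator `(T(g) f)(x) = τ(x; g) f(x · g)` in `L²(X, μ)`. -/
def op (h : IsCocycle μ act τ) (g : G) : Lp ℂ 2 μ →ₗᵢ[ℂ] Lp ℂ 2 μ where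
  toFun f := (h.memLp g f).toLp fun x => τ x g * f (act x g)
  map_add' f₁ f₂ := by
    refine Lp.ext ?_
    filter_upwards [(h.memLp g (f₁ + f₂)).coeFn_toLp, (h.memLp g f₁).coeFn_toLp,
      (h.memLp g f₂).coeFn_toLp, Lp.coeFn_add ((h.memLp g f₁).toLp _) ((h.memLp g f₂).toLp _),
      (h.quasi g).ae (Lp.coeFn_add f₁ f₂)] with x h₁ h₂ h₃ h₄ h₅
    rw [h₁, h₄, Pi.add_apply, h₂, h₃, h₅, Pi.add_apply, mul_add]
  map_smul' c f := by
    refine Lp.ext ?_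
    filter_upwards [(h.memLp g (c • f)).coeFn_toLp, (h.memLp g f).coeFn_toLp,
      Lp.coeFn_smul c ((h.memLp g f).toLp _),
      (h.quasi g).ae (Lp.coeFn_smul c f)] with x h₁ h₂ h₃ h₄
    rw [h₁, RingHom.id_apply, h₃, Pi.smul_apply, h₂, h₄, Pi.smul_apply, smul_eq_mul, smul_eq_mul,
      mul_left_comm]
  norm_map' f := by
    change ‖(h.memLp g f).toLp _‖ = _
    rw [Lp.norm_toLp, h.eLpNorm_eq g (Lp.aestronglyMeasurable f), Lp.norm_def]

theorem coeFn_op (h : IsCocycle μ act τ) (g : G) (f : Lp ℂ 2 μ) :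
    h.op g f =ᵐ[μ] fun x => τ x g * f (act x g) :=
  (h.memLp g f).coeFn_toLp

/-- The unitary representation `(T(g) f)(x) = τ(x; g) f(x · g)` of `G` in `L²(X, μ)`. -/
def rep (h : IsCocycle μ act τ) : UnitaryRep G (Lp ℂ 2 μ) :=
  UnitaryRep.ofIsometries h.op
    (fun f => Lp.ext <| by
      filter_upwards [h.coeFn_op 1 f] with x hx
      rw [hx, h.cocycle_one, h.act_one, one_mul])
    (fun g₁ g₂ f => Lp.ext <| by
      filter_upwards [h.coeFn_op (g₁ * g₂) f, h.coeFn_op g₁ (h.op g₂ f),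
        (h.quasi g₁).ae (h.coeFn_op g₂ f)] with x h₁ h₂ h₃
      rw [h₁, h₂, h₃, h.act_mul, h.cocycle_mul]
      ring)

theorem coeFn_rep (h : IsCocycle μ act τ) (g : G) (f : Lp ℂ 2 μ) :
    h.rep g f =ᵐ[μ] fun x => τ x g * f (act x g) :=
  h.coeFn_op g f

end IsCocycle

/-! ### Pairings -/

/-- The set `{-n, …, -1, 1, …, n}`. -/
def pts (n : ℕ) : Finset ℤ := (Finset.Icc (-(n : ℤ)) n).erase 0

theorem mem_pts {n : ℕ} {i : ℤ} : i ∈ pts n ↔ i ≠ 0 ∧ -(n : ℤ) ≤ i ∧ i ≤ n := by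
  simp [pts]

/-- The space `X(n)` of pairings of `{-n, …, -1, 1, …, n}` into `n` unordered pairs. A pairing is
given by the map that sends every point to the other point of its pair: `{i, j}` is a pair of `x` iff
`x.partner i = j`, for `i` in `{-n, …, -1, 1, …, n}`. The integers outside of
`{-n, …, -1, 1, …, n}` belong to no pair; for them `x.partner i = i` by convention. -/
@[ext]
structure Pairing (n : ℕ) where
  partner : ℤ → ℤ
  partner_partner : ∀ i, partner (partner i) = i
  partner_eq_self_iff : ∀ i, partner i = i ↔ i ∉ pts n

namespace Pairing

variable {n : ℕ}

theorem partner_mem (x : Pairing n) {i : ℤ} (hi : i ∈ pts n) : x.partner i ∈ pts n := by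
  by_contra h
  have h₁ := (x.partner_eq_self_iff _).2 h
  rw [x.partner_partner] at h₁
  exact h (h₁ ▸ hi)

theorem partner_ne (x : Pairing n) {i : ℤ} (hi : i ∈ pts n) : x.partner i ≠ i :=
  fun h => (x.partner_eq_self_iff i).1 h hi

theorem partner_of_notMem (x : Pairing n) {i : ℤ} (hi : i ∉ pts n) : x.partner i = i :=
  (x.partner_eq_self_iff i).2 hi

theorem partner_inj (x : Pairing n) {i j : ℤ} (h : x.partner i = x.partner j) : i = j := by
  rw [← x.partner_partner i, h, x.partner_partner]

instance : Finite (Pairing n) := by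
  refine Finite.of_injective
    (fun (x : Pairing n) (i : pts n) => (⟨x.partner i, x.partner_mem i.2⟩ : pts n)) ?_
  intro x y h
  ext i
  by_cases hi : i ∈ pts n
  · exact congrArg Subtype.val (congrFun h ⟨i, hi⟩)
  · rw [x.partner_of_notMem hi, y.partner_of_notMem hi]

instance : MeasurableSpace (Pairing n) := ⊤

instance : DiscreteMeasurableSpace (Pairing n) := ⟨fun _ => trivial⟩

/-- The number `[x]_n` of cycles of `x`. A cycle is an alternating sequence of pairs `{i, j}` of `x`
and of steps from `i` to `-i`, so that the cycles are the classes of the equivalence relation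
generated by `i ∼ -i` and by `i ∼ j` for all pairs `{i, j}` of `x`. -/
def cycles (x : Pairing n) : ℕ :=
  Nat.card (Quot fun i j : pts n => (j : ℤ) = -i ∨ (j : ℤ) = x.partner i)

/-- The embedding of `X(n)` in `X(n+1)` which adds the pair `{-n-1, n+1}`. -/
def extend (x : Pairing n) : Pairing (n + 1) where
  partner i := if i = n + 1 then -(n + 1) else if i = -(n + 1) then n + 1 else x.partner i
  partner_partner i := by
    have h₁ : (n + 1 : ℤ) ∉ pts n := by simp [mem_pts]
    have h₂ : (-(n + 1) : ℤ) ∉ pts n := by simp [mem_pts]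
    have h₃ := x.partner_of_notMem h₁
    have h₄ := x.partner_of_notMem h₂
    have h₅ := x.partner_partner i
    split_ifs <;> grind
  partner_eq_self_iff i := by
    have h₁ := x.partner_eq_self_iff i
    simp only [mem_pts, Nat.cast_add, Nat.cast_one] at h₁ ⊢
    split_ifs <;> grind

/-- The canonical projection `p_{n,n+1} : X(n+1) → X(n)`: if `{-n-1, n+1}` is a pair, then it is
deleted; otherwise the pairs `{i, -n-1}` and `{k, n+1}` are replaced by the pair `{i, k}`. -/
def proj (x : Pairing (n + 1)) : Pairing n where
  partner i :=
    if i ∈ pts n then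
      if x.partner i = n + 1 then x.partner (-(n + 1))
      else if x.partner i = -(n + 1) then x.partner (n + 1)
      else x.partner i
    else i
  partner_partner i := by
    have h₀ : ∀ j, j ∈ pts (n + 1) ↔ j ∈ pts n ∨ j = n + 1 ∨ j = -(n + 1) := by
      intro j; simp only [mem_pts, Nat.cast_add, Nat.cast_one]; omega
    have h₁ : (n + 1 : ℤ) ∉ pts n := by simp [mem_pts]
    have h₂ : (-(n + 1) : ℤ) ∉ pts n := by simp [mem_pts]
    have h₃ := x.partner_partner
    have h₄ : ∀ j, j ∈ pts (n + 1) → x.partner j ∈ pts (n + 1) := fun j => x.partner_mem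
    have h₅ : ∀ j, j ∈ pts (n + 1) → x.partner j ≠ j := fun j => x.partner_ne
    have h₆ : (n + 1 : ℤ) ≠ -(n + 1) := by omega
    grind
  partner_eq_self_iff i := by
    have h₀ : ∀ j, j ∈ pts (n + 1) ↔ j ∈ pts n ∨ j = n + 1 ∨ j = -(n + 1) := by
      intro j; simp only [mem_pts, Nat.cast_add, Nat.cast_one]; omega
    have h₁ : (n + 1 : ℤ) ∉ pts n := by simp [mem_pts]
    have h₂ : (-(n + 1) : ℤ) ∉ pts n := by simp [mem_pts]
    have h₃ := x.partner_partner
    have h₅ : ∀ j, j ∈ pts (n + 1) → x.partner j ≠ j := fun j => x.partner_ne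
    have h₆ : (n + 1 : ℤ) ≠ -(n + 1) := by omega
    grind

/-- If `{-n-1, n+1}` is not a pair of `x`, the projection does not change the number of cycles; if it
is, one cycle is deleted. -/
theorem cycles_proj (x : Pairing (n + 1)) :
    x.cycles = x.proj.cycles + if x.partner (n + 1) = -(n + 1) then 1 else 0 := by
  have h₀ : ∀ j, j ∈ pts (n + 1) ↔ j ∈ pts n ∨ j = n + 1 ∨ j = -(n + 1) := by
    intro j; simp only [mem_pts, Nat.cast_add, Nat.cast_one]; omega
  have h₁ : (n + 1 : ℤ) ∉ pts n := by simp [mem_pts]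
  have h₂ : (-(n + 1) : ℤ) ∉ pts n := by simp [mem_pts]
  have h₃ := x.partner_partner
  have h₄ : ∀ j, j ∈ pts (n + 1) → x.partner j ∈ pts (n + 1) := fun j => x.partner_mem
  have h₅ : ∀ j, j ∈ pts (n + 1) → x.partner j ≠ j := fun j => x.partner_ne
  have h₆ : (n + 1 : ℤ) ≠ -(n + 1) := by omega
  have hneg : ∀ j, j ∈ pts n → -j ∈ pts n := by intro j; simp only [mem_pts]; omega
  have ha : (n + 1 : ℤ) ∈ pts (n + 1) := by rw [h₀]; simp
  have hb : (-(n + 1) : ℤ) ∈ pts (n + 1) := by rw [h₀]; simp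
  let a : pts (n + 1) := ⟨n + 1, ha⟩
  let b : pts (n + 1) := ⟨-(n + 1), hb⟩
  let r : pts (n + 1) → pts (n + 1) → Prop := fun i j => (j : ℤ) = -i ∨ (j : ℤ) = x.partner i
  let s : pts n → pts n → Prop := fun i j => (j : ℤ) = -i ∨ (j : ℤ) = x.proj.partner i
  have hp : ∀ i ∈ pts n, x.proj.partner i = if x.partner i = n + 1 then x.partner (-(n + 1))
      else if x.partner i = -(n + 1) then x.partner (n + 1) else x.partner i := by
    intro i hi; simp [proj, hi]
  have hcast : ∀ i, i ∈ pts n → i ∈ pts (n + 1) := fun i hi => (h₀ i).2 (Or.inl hi)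
  let c : pts n → pts (n + 1) := fun i => ⟨i, hcast i i.2⟩
  have hab : Quot.mk r a = Quot.mk r b := Quot.sound (Or.inl rfl)
  have hpar : ∀ i j : pts (n + 1), (j : ℤ) = x.partner i → Quot.mk r i = Quot.mk r j :=
    fun i j h => Quot.sound (Or.inr h)
  -- the map induced by the inclusion of the points
  have hc : ∀ i j : pts n, s i j → Quot.mk r (c i) = Quot.mk r (c j) := by
    rintro i j (h | h)
    · exact Quot.sound (Or.inl h)
    · rw [hp i i.2] at h
      split_ifs at h with k₁ k₂
      · rw [hpar (c i) a k₁.symm, hab, hpar b (c j) h]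
      · rw [hpar (c i) b k₂.symm, ← hab, hpar a (c j) h]
      · exact hpar _ _ h
  change Nat.card (Quot r) = Nat.card (Quot s) + _
  split_ifs with hx
  · have hx' : x.partner (-(n + 1)) = n + 1 := by rw [← hx, h₃]
    let f : pts (n + 1) → Option (Quot s) := fun i =>
      if h : (i : ℤ) ∈ pts n then some (Quot.mk s ⟨i, h⟩) else none
    have hf : ∀ i j, r i j → f i = f j := by
      rintro ⟨i, hi⟩ ⟨j, hj⟩ h
      have hm : i ∈ pts n ↔ j ∈ pts n := by
        rcases h with h | h <;> simp only at h <;> subst h <;> grind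
      by_cases hi' : i ∈ pts n
      · have hj' := hm.1 hi'
        simp only [f, hi', hj', dif_pos]
        congr 1
        refine Quot.sound ?_
        rcases h with h | h
        · exact Or.inl h
        · right
          rw [hp i hi']
          simp only at h ⊢
          grind
      · have hj' : j ∉ pts n := fun h => hi' (hm.2 h)
        simp only [f, hi', hj', dif_neg, not_false_eq_true]
    let e : Quot r ≃ Option (Quot s) :=
      { toFun := Quot.lift f hf
        invFun := fun o => o.elim (Quot.mk r a) (Quot.lift (fun i => Quot.mk r (c i)) hc)
        left_inv := by
          rintro ⟨i, hi⟩
          by_cases hi' : i ∈ pts n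
          · simp [f, hi', c]
          · have : i = n + 1 ∨ i = -(n + 1) := by grind
            rcases this with rfl | rfl
            · simp [f, hi', a]
            · simp only [f, hi', dif_neg, not_false_eq_true, Option.elim]
              exact hab
        right_inv := by
          rintro (_ | ⟨i, hi⟩)
          · simp [f, a, h₁]
          · simp [f, c, hi] }
    rw [Nat.card_congr e, Finite.card_option]
  · have hxa : x.partner (n + 1) ∈ pts n := by grind
    have hxb : x.partner (-(n + 1)) ∈ pts n := by grind
    have hs : Quot.mk s ⟨_, hxa⟩ = Quot.mk s ⟨_, hxb⟩ := by
      refine Quot.sound (Or.inr ?_)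
      rw [hp _ hxa]
      simp [h₃]
    let f : pts (n + 1) → Quot s := fun i =>
      if h : (i : ℤ) ∈ pts n then Quot.mk s ⟨i, h⟩ else Quot.mk s ⟨_, hxa⟩
    have hf : ∀ i j, r i j → f i = f j := by
      rintro ⟨i, hi⟩ ⟨j, hj⟩ h
      rcases h with h | h <;> simp only at h
      · subst h
        by_cases hi' : i ∈ pts n
        · simp only [f, hi', hneg i hi', dif_pos]
          exact Quot.sound (Or.inl rfl)
        · have : -i ∉ pts n := fun h => hi' (by simpa using hneg _ h)
          simp only [f, hi', this, dif_neg, not_false_eq_true]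
      · subst h
        by_cases hi' : i ∈ pts n
        · by_cases hj' : x.partner i ∈ pts n
          · simp only [f, hi', hj', dif_pos]
            refine Quot.sound (Or.inr ?_)
            rw [hp i hi']
            simp only
            grind
          · simp only [f, hi', hj', dif_pos, dif_neg, not_false_eq_true]
            have : x.partner i = n + 1 ∨ x.partner i = -(n + 1) := by grind
            rcases this with k | k
            · congr 2; rw [← k, h₃]
            · rw [hs]; congr 2; rw [← k, h₃]
        · have : i = n + 1 ∨ i = -(n + 1) := by grind
          rcases this with rfl | rfl
          · simp only [f, hi', hxa, dif_pos, dif_neg, not_false_eq_true]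
          · simp only [f, hi', hxb, dif_pos, dif_neg, not_false_eq_true]
            exact hs
    let e : Quot r ≃ Quot s :=
      { toFun := Quot.lift f hf
        invFun := Quot.lift (fun i => Quot.mk r (c i)) hc
        left_inv := by
          rintro ⟨i, hi⟩
          by_cases hi' : i ∈ pts n
          · simp [f, hi', c]
          · simp only [f, hi', dif_neg, not_false_eq_true]
            have : i = n + 1 ∨ i = -(n + 1) := by grind
            rcases this with rfl | rfl
            · exact (hpar a _ rfl).symm
            · exact ((hpar a _ rfl).symm).trans hab
        right_inv := by
          rintro ⟨i, hi⟩
          simp [f, c, hi] }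
    rw [Nat.card_congr e, add_zero]

end Pairing

/-! ### The groups `S(2n)` and `S(2∞)` and their actions -/

/-- The group `S(2n)` of permutations of `{-n, …, -1, 1, …, n}`, realized as the group of those
permutations of `ℤ` that fix all other integers, so that `S(2n) ⊆ S(2n+2)`. Permutations are
multiplied from left to right (`g₁ g₂` is `g₁` followed by `g₂`), that is, in the opposite of the
group `Equiv.Perm ℤ`: with this product `x ↦ x · g` below is a right action. -/
def S2 (n : ℕ) : Subgroup (Equiv.Perm ℤ)ᵐᵒᵖ where
  carrier := {g | ∀ i, i ∉ pts n → g.unop i = i}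
  mul_mem' {a b} ha hb i hi := by
    rw [MulOpposite.unop_mul, Equiv.Perm.mul_apply, ha i hi, hb i hi]
  one_mem' _ _ := rfl
  inv_mem' {a} ha i hi := by
    rw [MulOpposite.unop_inv, Equiv.Perm.inv_eq_iff_eq, ha i hi]

theorem S2_mono : Monotone S2 := by
  intro m n h g hg i hi
  refine hg i fun hi' => hi ?_
  rw [mem_pts] at hi' ⊢
  omega

theorem S2_succ_mono : Monotone fun n => S2 (n + 1) := fun _ _ h => S2_mono (Nat.succ_le_succ h)

/-- The group `S(2∞) = ⋃ S(2n)`, the union over `n ≥ 1`. -/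
abbrev S2inf : Subgroup (Equiv.Perm ℤ)ᵐᵒᵖ := ⨆ n, S2 (n + 1)

theorem exists_mem_S2 (g : S2inf) : ∃ n, (g : (Equiv.Perm ℤ)ᵐᵒᵖ) ∈ S2 n :=
  have ⟨n, h⟩ := (Subgroup.mem_iSup_of_directed S2_succ_mono.directed_le).1 g.2
  ⟨n + 1, h⟩

/-- The least `n` such that `g ∈ S(2∞)` lies in `S(2n)`. -/
def level (g : S2inf) : ℕ := sInf {n | (g : (Equiv.Perm ℤ)ᵐᵒᵖ) ∈ S2 n}

theorem mem_level (g : S2inf) : (g : (Equiv.Perm ℤ)ᵐᵒᵖ) ∈ S2 (level g) :=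
  Nat.sInf_mem (exists_mem_S2 g)

theorem level_le {g : S2inf} {n : ℕ} (h : (g : (Equiv.Perm ℤ)ᵐᵒᵖ) ∈ S2 n) : level g ≤ n :=
  Nat.sInf_le h

theorem S2_apply_mem {n : ℕ} {g : (Equiv.Perm ℤ)ᵐᵒᵖ} (hg : g ∈ S2 n) (i : ℤ) :
    g.unop i ∈ pts n ↔ i ∈ pts n := by
  constructor
  · intro h
    by_contra hi
    rw [hg i hi] at h
    exact hi h
  · intro h
    by_contra hi
    have h₁ := g.unop.injective (hg _ hi)
    rw [h₁] at hi
    exact hi h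

namespace Pairing

variable {n : ℕ}

/-- The right action of `S(2n)` on `X(n)`: the pairs of `x · g` are `{g(i), g(j)}` for the pairs
`{i, j}` of `x`. -/
def act (x : Pairing n) (g : S2 n) : Pairing n where
  partner i := g.1.unop (x.partner (g.1.unop⁻¹ i))
  partner_partner i := by simp [x.partner_partner]
  partner_eq_self_iff i := by
    rw [← Equiv.Perm.eq_inv_iff_eq, x.partner_eq_self_iff]
    have := S2_apply_mem g.2 (g.1.unop⁻¹ i)
    rw [← this]; simp

theorem act_one (x : Pairing n) : x.act 1 = x := rfl

theorem act_mul (x : Pairing n) (g₁ g₂ : S2 n) : x.act (g₁ * g₂) = (x.act g₁).act g₂ := rfl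

theorem proj_extend (x : Pairing n) : x.extend.proj = x := by
  have h₁ : (n + 1 : ℤ) ∉ pts n := by simp [mem_pts]
  have h₂ : (-(n + 1) : ℤ) ∉ pts n := by simp [mem_pts]
  have h₄ : ∀ j, j ∈ pts n → x.partner j ∈ pts n := fun j => x.partner_mem
  have h₅ : ∀ j, j ∉ pts n → x.partner j = j := fun j => x.partner_of_notMem
  ext i
  simp only [proj, extend]
  grind

theorem proj_act (x : Pairing (n + 1)) (g : S2 n) :
    (x.act (Subgroup.inclusion (S2_mono n.le_succ) g)).proj = x.proj.act g := by
  have ha : g.1.unop (n + 1) = n + 1 := g.2 _ (by simp [mem_pts])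
  have hb : g.1.unop (-(n + 1)) = -(n + 1) := g.2 _ (by simp [mem_pts])
  have ha' : g.1.unop⁻¹ (n + 1) = n + 1 := by rw [Equiv.Perm.inv_eq_iff_eq, ha]
  have hb' : g.1.unop⁻¹ (-(n + 1)) = -(n + 1) := by rw [Equiv.Perm.inv_eq_iff_eq, hb]
  ext i
  simp only [act, proj, Subgroup.coe_inclusion]
  have hm := S2_apply_mem g.2 (g.1.unop⁻¹ i)
  rw [show g.1.unop (g.1.unop⁻¹ i) = i by simp] at hm
  have k₁ : ∀ j, g.1.unop j = n + 1 ↔ j = n + 1 := by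
    intro j; rw [← Equiv.Perm.eq_inv_iff_eq, ha']
  have k₂ : ∀ j, g.1.unop j = -(n + 1) ↔ j = -(n + 1) := by
    intro j; rw [← Equiv.Perm.eq_inv_iff_eq, hb']
  simp only [ha', hb', k₁, k₂]
  by_cases hi : i ∈ pts n
  · rw [if_pos hi, if_pos (hm.1 hi)]
    split_ifs <;> rfl
  · rw [if_neg hi, if_neg fun h => hi (hm.2 h)]
    simp

/-- The increment of the number of cycles is stable under the projection. -/
theorem cycles_act_proj (x : Pairing (n + 1)) (g : S2 n) :
    ((x.act (Subgroup.inclusion (S2_mono n.le_succ) g)).cycles : ℤ) - x.cycles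
      = (x.proj.act g).cycles - x.proj.cycles := by
  have ha : g.1.unop (n + 1) = n + 1 := g.2 _ (by simp [mem_pts])
  have hb : g.1.unop (-(n + 1)) = -(n + 1) := g.2 _ (by simp [mem_pts])
  have ha' : g.1.unop⁻¹ (n + 1) = n + 1 := by rw [Equiv.Perm.inv_eq_iff_eq, ha]
  have hb' : g.1.unop⁻¹ (-(n + 1)) = -(n + 1) := by rw [Equiv.Perm.inv_eq_iff_eq, hb]
  have : (x.act (Subgroup.inclusion (S2_mono n.le_succ) g)).partner (n + 1) = -(n + 1)
      ↔ x.partner (n + 1) = -(n + 1) := by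
    simp only [act, Subgroup.coe_inclusion]
    rw [ha', ← Equiv.Perm.eq_inv_iff_eq, hb']
  rw [cycles_proj, cycles_proj x, proj_act]
  simp only [this]
  push_cast
  ring

end Pairing

/-! ### The projective limit `X` -/

/-- The projective limit `X` of the spaces `X(n)` along the canonical projections. (The sequences
here start with the one-point space `X(0)`, which carries no information.) -/
def PairingLimit : Type := {x : ∀ n, Pairing n // ∀ n, (x (n + 1)).proj = x n}

namespace PairingLimit

/-- The projection `p_n : X → X(n)`. -/
def coord (n : ℕ) (x : PairingLimit) : Pairing n := x.1 n

/-- The Borel structure of `X`, generated by the projections to the finite spaces `X(n)`. -/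
instance : MeasurableSpace PairingLimit :=
  inferInstanceAs (MeasurableSpace {x : ∀ n, Pairing n // ∀ n, (x (n + 1)).proj = x n})

theorem measurable_coord (n : ℕ) : Measurable (coord n) :=
  (measurable_pi_apply n).comp measurable_subtype_coe

theorem proj_coord (n : ℕ) (x : PairingLimit) : (x.coord (n + 1)).proj = x.coord n := x.2 n

theorem ext_coord {x y : PairingLimit} (h : ∀ n, x.coord n = y.coord n) : x = y :=
  Subtype.ext (funext h)

/-- Iterated projection `X(m) → X(n)` for `n ≤ m`. -/
def down {m n : ℕ} (h : n ≤ m) (x : Pairing m) : Pairing n :=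
  Nat.decreasingInduction (motive := fun k _ => Pairing k) (fun _ _ y => y.proj) x h

theorem down_self {m : ℕ} (x : Pairing m) : down le_rfl x = x :=
  Nat.decreasingInduction_self _ _

theorem proj_down {m n : ℕ} (h : n + 1 ≤ m) (x : Pairing m) :
    (down h x).proj = down (n.le_succ.trans h) x :=
  (Nat.decreasingInduction_succ_left (motive := fun k _ => Pairing k) (fun _ _ y => y.proj) x
    h _).symm

theorem down_coord {m n : ℕ} (h : n ≤ m) (x : PairingLimit) :
    down h (x.coord m) = x.coord n := by
  induction h using Nat.decreasingInduction with
  | self => exact down_self _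
  | of_succ k hk ih => rw [← proj_down hk, ih, proj_coord]

/-- The `n`-th coordinate of `x · g`: it is `x_n · g` if `g ∈ S(2n)`, and for smaller `n` it is the
projection of `x_N · g`, where `N` is the least number such that `g ∈ S(2N)`. -/
def actCoord (x : PairingLimit) (g : S2inf) (n : ℕ) : Pairing n :=
  if h : level g ≤ n then (x.coord n).act ⟨g, S2_mono h (mem_level g)⟩
  else down (not_le.1 h).le ((x.coord (level g)).act ⟨g, mem_level g⟩)

theorem actCoord_of_le (x : PairingLimit) {g : S2inf} {n : ℕ} (h : level g ≤ n) :
    actCoord x g n = (x.coord n).act ⟨g, S2_mono h (mem_level g)⟩ :=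
  dif_pos h

theorem actCoord_of_ge (x : PairingLimit) {g : S2inf} {n : ℕ} (h : n ≤ level g) :
    actCoord x g n = down h ((x.coord (level g)).act ⟨g, mem_level g⟩) := by
  rcases h.lt_or_eq with h' | h'
  · exact dif_neg (not_le.2 h')
  · subst h'
    rw [actCoord_of_le x le_rfl, down_self]

/-- The right action of `S(2∞)` on `X`: if `y = x · g`, then `y_n = x_n · g` for all `n` so large
that `g ∈ S(2n)`. -/
def act (x : PairingLimit) (g : S2inf) : PairingLimit :=
  ⟨actCoord x g, by
    intro n
    by_cases h : level g ≤ n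
    · rw [actCoord_of_le x h, actCoord_of_le x (h.trans n.le_succ), ← proj_coord n x]
      exact Pairing.proj_act (x.coord (n + 1)) ⟨g, S2_mono h (mem_level g)⟩
    · rw [actCoord_of_ge x (not_le.1 h).le, actCoord_of_ge x (Nat.succ_le_of_lt (not_le.1 h)),
        proj_down]⟩

theorem coord_act (x : PairingLimit) (g : S2inf) (n : ℕ) (h : (g : (Equiv.Perm ℤ)ᵐᵒᵖ) ∈ S2 n) :
    (x.act g).coord n = (x.coord n).act ⟨g, h⟩ :=
  actCoord_of_le x (level_le h)

theorem ext_coord_ge {x y : PairingLimit} (N : ℕ) (h : ∀ n, N ≤ n → x.coord n = y.coord n) :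
    x = y := by
  refine ext_coord fun n => ?_
  rw [← down_coord (le_max_left n N), ← down_coord (le_max_left n N), h _ (le_max_right n N)]

theorem act_one (x : PairingLimit) : x.act 1 = x :=
  ext_coord fun n => by rw [coord_act x 1 n (S2 n).one_mem]; rfl

theorem act_mul (x : PairingLimit) (g₁ g₂ : S2inf) : x.act (g₁ * g₂) = (x.act g₁).act g₂ := by
  refine ext_coord_ge (max (level g₁) (level g₂)) fun n hn => ?_
  have h₁ := S2_mono ((le_max_left _ _).trans hn) (mem_level g₁)
  have h₂ := S2_mono ((le_max_right _ _).trans hn) (mem_level g₂)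
  rw [coord_act _ _ n ((S2 n).mul_mem h₁ h₂), coord_act _ _ n h₂, coord_act _ _ n h₁]
  rfl

/-- The fundamental cocycle `c(x; g) = [p_n(x) · g]_n - [p_n(x)]_n`, where `n` is so large that
`g ∈ S(2n)`. -/
def cocycle (x : PairingLimit) (g : S2inf) : ℤ :=
  ((x.coord (level g)).act ⟨g, mem_level g⟩).cycles - (x.coord (level g)).cycles

/-- The definition of the fundamental cocycle does not depend on `n`. -/
theorem cocycle_eq (x : PairingLimit) (g : S2inf) (n : ℕ)
    (h : (g : (Equiv.Perm ℤ)ᵐᵒᵖ) ∈ S2 n) :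
    x.cocycle g = ((x.coord n).act ⟨g, h⟩).cycles - (x.coord n).cycles := by
  have hn := level_le h
  induction n, hn using Nat.le_induction with
  | base => rfl
  | succ n hn ih =>
    have h' := S2_mono hn (mem_level g)
    rw [ih h', ← proj_coord n x]
    exact (Pairing.cycles_act_proj (x.coord (n + 1)) ⟨g, h'⟩).symm

theorem cocycle_mul (x : PairingLimit) (g₁ g₂ : S2inf) :
    x.cocycle (g₁ * g₂) = (x.act g₁).cocycle g₂ + x.cocycle g₁ := by
  set n := max (level g₁) (level g₂)
  have h₁ := S2_mono (le_max_left _ _ : _ ≤ n) (mem_level g₁)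
  have h₂ := S2_mono (le_max_right _ _ : _ ≤ n) (mem_level g₂)
  rw [cocycle_eq x _ n ((S2 n).mul_mem h₁ h₂), cocycle_eq x g₁ n h₁, cocycle_eq _ g₂ n h₂,
    coord_act x g₁ n h₁]
  have : (x.coord n).act ⟨(g₁ * g₂ : S2inf), (S2 n).mul_mem h₁ h₂⟩
      = ((x.coord n).act ⟨g₁, h₁⟩).act ⟨g₂, h₂⟩ := rfl
  rw [this]
  ring

theorem measurable_of_coord {α : Type} [MeasurableSpace α] {f : α → PairingLimit}
    (h : ∀ n, Measurable fun a => (f a).coord n) : Measurable f :=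
  (measurable_pi_lambda _ h).subtype_mk

theorem measurable_act (g : S2inf) : Measurable fun x => act x g := by
  refine measurable_of_coord fun n => ?_
  by_cases h : level g ≤ n
  · have : (fun x => (act x g).coord n)
        = (fun y : Pairing n => y.act ⟨g, S2_mono h (mem_level g)⟩) ∘ coord n := by
      ext1 x; exact actCoord_of_le x h
    rw [this]
    exact (measurable_of_finite _).comp (measurable_coord n)
  · have : (fun x => (act x g).coord n)
        = (fun y => down (not_le.1 h).le (Pairing.act y ⟨g, mem_level g⟩)) ∘ coord (level g) := by
      ext1 x; exact actCoord_of_ge x (not_le.1 h).le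
    rw [this]
    exact (measurable_of_finite _).comp (measurable_coord _)

end PairingLimit

/-! ### The measures -/

namespace Pairing

/-- The normalized Haar measure `μ_1^{(n)}` on the homogeneous space `X(n)`: the uniform probability
measure. -/
def haar (n : ℕ) : Measure (Pairing n) := (Nat.card (Pairing n) : ℝ≥0∞)⁻¹ • Measure.count

/-- The measure `μ_t^{(n)}` on `X(n)`: the weight of `x` is `t ^ [x]_n / (t (t+2) ⋯ (t+2n-2))`. -/
def ewens (t : ℝ) (n : ℕ) : Measure (Pairing n) :=
  Measure.count.withDensity fun x =>
    ENNReal.ofReal (t ^ x.cycles / ∏ k ∈ Finset.range n, (t + 2 * k))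

theorem count_withDensity_singleton {α : Type} [MeasurableSpace α] [DiscreteMeasurableSpace α]
    (w : α → ℝ≥0∞) (a : α) : Measure.count.withDensity w {a} = w a := by
  rw [withDensity_apply _ (measurableSet_singleton a), Measure.restrict_singleton,
    Measure.count_singleton, one_smul, lintegral_dirac]

theorem ewens_singleton (t : ℝ) (n : ℕ) (x : Pairing n) :
    ewens t n {x} = ENNReal.ofReal (t ^ x.cycles / ∏ k ∈ Finset.range n, (t + 2 * k)) :=
  count_withDensity_singleton _ x

instance : Subsingleton (Pairing 0) := by
  constructor
  intro x y
  have h : ∀ i, i ∉ pts 0 := by intro i; rw [mem_pts]; push_cast; omega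
  ext i
  rw [x.partner_of_notMem (h i), y.partner_of_notMem (h i)]

/-- The pairing of the empty set. -/
def empty : Pairing 0 where
  partner i := i
  partner_partner _ := rfl
  partner_eq_self_iff i := by
    have : i ∉ pts 0 := by rw [mem_pts]; push_cast; omega
    simpa

theorem cycles_zero (x : Pairing 0) : x.cycles = 0 := by
  have : IsEmpty (pts 0) := ⟨fun i => by have := mem_pts.1 i.2; push_cast at this; omega⟩
  have : IsEmpty (Quot fun i j : pts 0 => (j : ℤ) = -i ∨ (j : ℤ) = x.partner i) :=
    ⟨fun q => isEmptyElim q.out⟩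
  exact Nat.card_of_isEmpty

/-- The points of a fibre of the canonical projection `X(n+1) → X(n)`: the new pair `{-n-1, n+1}` is
added, or one of the `2n` points is chosen as the partner of `n+1`. -/
abbrev Code (n : ℕ) : Type := Option (pts n)

instance (n : ℕ) : MeasurableSpace (Code n) := ⊤
instance (n : ℕ) : DiscreteMeasurableSpace (Code n) := ⟨fun _ => trivial⟩

/-- The position of `x` in its fibre. -/
def code {n : ℕ} (x : Pairing (n + 1)) : Code n :=
  if h : x.partner (n + 1) ∈ pts n then some ⟨_, h⟩ else none

/-- The point of the fibre over `y` with the given position. -/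
def insert {n : ℕ} (y : Pairing n) : Code n → Pairing (n + 1)
  | none => y.extend
  | some j =>
    { partner := fun i => if i = n + 1 then j else if i = -(n + 1) then y.partner j
        else if i = j then n + 1 else if i = y.partner j then -(n + 1) else y.partner i
      partner_partner := fun i => by
        have h₁ : (n + 1 : ℤ) ∉ pts n := by simp [mem_pts]
        have h₂ : (-(n + 1) : ℤ) ∉ pts n := by simp [mem_pts]
        have h₃ := y.partner_partner
        have h₄ : ∀ j, j ∈ pts n → y.partner j ∈ pts n := fun j => y.partner_mem
        have h₅ : ∀ j, j ∈ pts n → y.partner j ≠ j := fun j => y.partner_ne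
        have h₆ : ∀ j, j ∉ pts n → y.partner j = j := fun j => y.partner_of_notMem
        have h₇ : (n + 1 : ℤ) ≠ -(n + 1) := by omega
        have hj := j.2
        grind
      partner_eq_self_iff := fun i => by
        have h₀ : ∀ j, j ∈ pts (n + 1) ↔ j ∈ pts n ∨ j = n + 1 ∨ j = -(n + 1) := by
          intro j; simp only [mem_pts, Nat.cast_add, Nat.cast_one]; omega
        have h₁ : (n + 1 : ℤ) ∉ pts n := by simp [mem_pts]
        have h₂ : (-(n + 1) : ℤ) ∉ pts n := by simp [mem_pts]
        have h₃ := y.partner_partner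
        have h₄ : ∀ j, j ∈ pts n → y.partner j ∈ pts n := fun j => y.partner_mem
        have h₅ : ∀ j, j ∈ pts n → y.partner j ≠ j := fun j => y.partner_ne
        have h₆ : ∀ j, j ∉ pts n → y.partner j = j := fun j => y.partner_of_notMem
        have h₇ : (n + 1 : ℤ) ≠ -(n + 1) := by omega
        have hj := j.2
        grind }

theorem proj_insert {n : ℕ} (y : Pairing n) (c : Code n) : (y.insert c).proj = y := by
  rcases c with _ | j
  · exact proj_extend y
  · have h₁ : (n + 1 : ℤ) ∉ pts n := by simp [mem_pts]
    have h₂ : (-(n + 1) : ℤ) ∉ pts n := by simp [mem_pts]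
    have h₃ := y.partner_partner
    have h₄ : ∀ j, j ∈ pts n → y.partner j ∈ pts n := fun j => y.partner_mem
    have h₅ : ∀ j, j ∈ pts n → y.partner j ≠ j := fun j => y.partner_ne
    have h₆ : ∀ j, j ∉ pts n → y.partner j = j := fun j => y.partner_of_notMem
    have h₇ : (n + 1 : ℤ) ≠ -(n + 1) := by omega
    have hj := j.2
    ext i
    simp only [proj, insert]
    grind

theorem code_insert {n : ℕ} (y : Pairing n) (c : Code n) : (y.insert c).code = c := by
  rcases c with _ | j
  · have h₂ : (-(n + 1) : ℤ) ∉ pts n := by simp [mem_pts]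
    have : (y.insert none).partner (n + 1) = -(n + 1) := by simp [insert, extend]
    rw [code, dif_neg (by rwa [this])]
  · have : (y.insert (some j)).partner (n + 1) = j := by simp [insert]
    rw [code, dif_pos (by rw [this]; exact j.2)]
    exact congrArg some (Subtype.ext this)

theorem insert_proj_code {n : ℕ} (x : Pairing (n + 1)) : x.proj.insert x.code = x := by
  have h₀ : ∀ j, j ∈ pts (n + 1) ↔ j ∈ pts n ∨ j = n + 1 ∨ j = -(n + 1) := by
    intro j; simp only [mem_pts, Nat.cast_add, Nat.cast_one]; omega
  have h₁ : (n + 1 : ℤ) ∉ pts n := by simp [mem_pts]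
  have h₂ : (-(n + 1) : ℤ) ∉ pts n := by simp [mem_pts]
  have h₃ := x.partner_partner
  have h₄ : ∀ j, j ∈ pts (n + 1) → x.partner j ∈ pts (n + 1) := fun j => x.partner_mem
  have h₅ : ∀ j, j ∈ pts (n + 1) → x.partner j ≠ j := fun j => x.partner_ne
  have h₆ : ∀ j, j ∉ pts (n + 1) → x.partner j = j := fun j => x.partner_of_notMem
  have h₇ : (n + 1 : ℤ) ≠ -(n + 1) := by omega
  ext i
  by_cases h : x.partner (n + 1) ∈ pts n
  · rw [code, dif_pos h]
    simp only [insert, proj]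
    grind
  · rw [code, dif_neg h]
    simp only [insert, extend, proj]
    grind

theorem code_eq_none_iff {n : ℕ} (x : Pairing (n + 1)) :
    x.code = none ↔ x.partner (n + 1) = -(n + 1) := by
  have h₀ : ∀ j, j ∈ pts (n + 1) ↔ j ∈ pts n ∨ j = n + 1 ∨ j = -(n + 1) := by
    intro j; simp only [mem_pts, Nat.cast_add, Nat.cast_one]; omega
  have h₂ : (-(n + 1) : ℤ) ∉ pts n := by simp [mem_pts]
  have h₄ := x.partner_mem ((h₀ (n + 1)).2 (by simp))
  have h₅ := x.partner_ne ((h₀ (n + 1)).2 (by simp))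
  rw [code]
  by_cases h : x.partner (n + 1) ∈ pts n
  · rw [dif_pos h]
    constructor
    · intro k; cases k
    · intro k; rw [k] at h; exact absurd h h₂
  · rw [dif_neg h]
    grind

theorem card_pts (n : ℕ) : (pts n).card = 2 * n := by
  rw [pts, Finset.card_erase_of_mem (by simp), Int.card_Icc]
  omega

/-- The weights of the positions in a fibre. -/
def codeWeight (t : ℝ) (n : ℕ) (c : Code n) : ℝ := (if c = none then t else 1) / (t + 2 * n)

theorem sum_codeWeight {t : ℝ} (ht : 0 < t) (n : ℕ) :
    ∑ c, ENNReal.ofReal (codeWeight t n c) = 1 := by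
  have h0 : ∀ c : Code n, 0 ≤ codeWeight t n c := by
    intro c; unfold codeWeight; split_ifs <;> positivity
  rw [← ENNReal.ofReal_sum_of_nonneg fun c _ => h0 c]
  have : ∑ c : Code n, codeWeight t n c = 1 := by
    have h := Fintype.sum_option (fun c : Option (pts n) => codeWeight t n c)
    refine h.trans ?_
    have h₁ : codeWeight t n none = t / (t + 2 * n) := by simp [codeWeight]
    have h₂ : ∀ i : pts n, codeWeight t n (some i) = 1 / (t + 2 * n) := by
      intro i
      have : (some i : Code n) ≠ none := Option.some_ne_none i
      simp [codeWeight, this]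
    simp only [h₁, h₂, Finset.sum_const, Finset.card_univ, Fintype.card_coe, card_pts]
    have h₃ : t + 2 * n ≠ 0 := by positivity
    rw [nsmul_eq_mul]
    push_cast
    field_simp
  rw [this, ENNReal.ofReal_one]

/-- The probability distribution on the positions in a fibre. -/
def codeMeasure {t : ℝ} (ht : 0 < t) (n : ℕ) : Measure (Code n) :=
  (PMF.ofFintype (fun c => ENNReal.ofReal (codeWeight t n c)) (sum_codeWeight ht n)).toMeasure

instance {t : ℝ} (ht : 0 < t) (n : ℕ) : IsProbabilityMeasure (codeMeasure ht n) :=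
  PMF.toMeasure.isProbabilityMeasure _

theorem codeMeasure_singleton {t : ℝ} (ht : 0 < t) (n : ℕ) (c : Code n) :
    codeMeasure ht n {c} = ENNReal.ofReal (codeWeight t n c) := by
  rw [codeMeasure, PMF.toMeasure_apply_singleton _ _ (measurableSet_singleton c),
    PMF.ofFintype_apply]

/-- The sequence of pairings with the given positions in the fibres. -/
def ofCodes (c : ∀ n, Code n) : ∀ n, Pairing n
  | 0 => empty
  | n + 1 => (ofCodes c n).insert (c n)

theorem ofCodes_event {t : ℝ} (ht : 0 < t) (n : ℕ) (y : Pairing n) :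
    ∃ e : ∀ k, Code k,
      {c | ofCodes c n = y} = Set.pi (Finset.range n : Set ℕ) (fun k => {e k}) ∧
      ∏ k ∈ Finset.range n, ENNReal.ofReal (codeWeight t k (e k)) = ewens t n {y} := by
  induction n with
  | zero =>
    refine ⟨fun _ => none, ?_, ?_⟩
    · ext c; simp [Subsingleton.elim (ofCodes c 0) y]
    · simp [ewens_singleton, cycles_zero]
  | succ n ih =>
    obtain ⟨e, he, hp⟩ := ih y.proj
    refine ⟨Function.update e n y.code, ?_, ?_⟩
    · ext c
      have h₁ : ofCodes c (n + 1) = y ↔ ofCodes c n = y.proj ∧ c n = y.code := by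
        constructor
        · intro h
          rw [← h]
          exact ⟨(proj_insert _ _).symm, (code_insert _ _).symm⟩
        · rintro ⟨h, h'⟩
          rw [ofCodes, h, h', insert_proj_code]
      have h₂ := Set.ext_iff.1 he c
      simp only [Set.mem_ofPred_eq, Set.mem_pi, Finset.mem_coe, Finset.mem_range,
        Set.mem_singleton_iff] at h₂ ⊢
      rw [h₁, h₂]
      constructor
      · rintro ⟨h, h'⟩ k hk
        rcases eq_or_ne k n with rfl | hkn
        · rw [h', Function.update_self]
        · rw [Function.update_of_ne hkn]; exact h k (by omega)
      · intro h
        refine ⟨fun k hk => ?_, ?_⟩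
        · have := h k (by omega)
          rwa [Function.update_of_ne hk.ne] at this
        · have := h n (by omega)
          rwa [Function.update_self] at this
    · rw [Finset.prod_range_succ, Function.update_self]
      have h₁ : ∏ k ∈ Finset.range n,
          ENNReal.ofReal (codeWeight t k (Function.update e n y.code k)) = ewens t n {y.proj} := by
        rw [← hp]
        refine Finset.prod_congr rfl fun k hk => ?_
        rw [Function.update_of_ne (Finset.mem_range.1 hk).ne]
      rw [h₁, ewens_singleton, ewens_singleton, ← ENNReal.ofReal_mul (by positivity)]
      congr 1
      rw [Finset.prod_range_succ, cycles_proj y, codeWeight]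
      simp only [code_eq_none_iff]
      split_ifs
      · rw [pow_succ]; field_simp
      · rw [add_zero]; field_simp

end Pairing

namespace PairingLimit

open Pairing

/-- The measures `μ_t^{(n)}` are probability measures, compatible with the canonical projections,
so that their projective limit exists. -/
theorem exists_mu {t : ℝ} (ht : 0 < t) :
    ∃ μ : Measure PairingLimit, IsProbabilityMeasure μ ∧ ∀ n, μ.map (coord n) = ewens t n := by
  let Φ : (∀ n, Code n) → PairingLimit := fun c => ⟨ofCodes c, fun n => proj_insert _ _⟩
  have hcoord : ∀ n, Measurable fun c => (Φ c).coord n := by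
    intro n
    refine measurable_to_countable' fun y => ?_
    obtain ⟨e, he, -⟩ := ofCodes_event ht n y
    have : (fun c => (Φ c).coord n) ⁻¹' {y} = {c | ofCodes c n = y} := rfl
    rw [this, he]
    exact MeasurableSet.pi (Finset.range n).countable_toSet fun k _ => measurableSet_singleton _
  have hΦ : Measurable Φ := measurable_of_coord hcoord
  refine ⟨(Measure.infinitePi fun n => codeMeasure ht n).map Φ,
    Measure.isProbabilityMeasure_map hΦ.aemeasurable, fun n => ?_⟩
  rw [Measure.map_map (measurable_coord n) hΦ]
  refine Measure.ext_iff_singleton.2 fun y => ?_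
  rw [Measure.map_apply (f := coord n ∘ Φ) (hcoord n) (measurableSet_singleton y)]
  obtain ⟨e, he, hp⟩ := ofCodes_event ht n y
  have : (coord n ∘ Φ) ⁻¹' {y} = {c | ofCodes c n = y} := rfl
  rw [this, he, Measure.infinitePi_pi _ fun k _ => measurableSet_singleton _, ← hp]
  simp only [codeMeasure_singleton]

/-- The measure `μ_t` on `X`: the projective limit of the measures `μ_t^{(n)}`, that is, the
probability measure whose image under every `p_n` is `μ_t^{(n)}` (it is unique by `measure_ext`). -/
def mu {t : ℝ} (ht : 0 < t) : Measure PairingLimit := Classical.choose (exists_mu ht)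

instance {t : ℝ} (ht : 0 < t) : IsProbabilityMeasure (mu ht) :=
  (Classical.choose_spec (exists_mu ht)).1

theorem map_coord_mu {t : ℝ} (ht : 0 < t) (n : ℕ) : (mu ht).map (coord n) = ewens t n :=
  (Classical.choose_spec (exists_mu ht)).2 n

/-- A finite measure on `X` is determined by its images on the spaces `X(n)`, for large `n`. -/
theorem measure_ext {μ ν : Measure PairingLimit} [IsFiniteMeasure μ] (N : ℕ)
    (h : ∀ n, N ≤ n → μ.map (coord n) = ν.map (coord n)) : μ = ν := by
  let C : Set (Set PairingLimit) :=
    {A | ∃ (n : ℕ) (_ : N ≤ n) (S : Set (Pairing n)), A = coord n ⁻¹' S}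
  have hdown : ∀ {m n : ℕ} (hmn : n ≤ m) (S : Set (Pairing n)),
      coord n ⁻¹' S = coord m ⁻¹' (down hmn ⁻¹' S) := by
    intro m n hmn S
    ext x
    simp only [Set.mem_preimage, down_coord]
  refine ext_of_generate_finite C ?_ ?_ ?_ ?_
  · refine le_antisymm ?_ (MeasurableSpace.generateFrom_le ?_)
    · have : @Measurable _ _ (MeasurableSpace.generateFrom C) _ (id : PairingLimit → _) := by
        refine @measurable_of_coord _ (MeasurableSpace.generateFrom C) _ fun n => ?_
        intro S _
        refine MeasurableSpace.measurableSet_generateFrom ?_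
        exact ⟨max n N, le_max_right _ _, down (le_max_left n N) ⁻¹' S, hdown _ S⟩
      exact fun A hA => this hA
    · rintro _ ⟨n, -, S, rfl⟩
      exact measurable_coord n S.toFinite.measurableSet
  · rintro _ ⟨m, hm, S, rfl⟩ _ ⟨n, hn, S', rfl⟩ -
    refine ⟨max m n, hm.trans (le_max_left _ _), down (le_max_left m n) ⁻¹' S ∩
      down (le_max_right m n) ⁻¹' S', ?_⟩
    rw [hdown (le_max_left m n), hdown (le_max_right m n) S', Set.preimage_inter]
  · rintro _ ⟨n, hn, S, rfl⟩
    have hS := S.toFinite.measurableSet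
    rw [← Measure.map_apply (measurable_coord n) hS, h n hn,
      Measure.map_apply (measurable_coord n) hS]
  · have := congrArg (fun ρ : Measure (Pairing N) => ρ Set.univ) (h N le_rfl)
    simpa [Measure.map_apply (measurable_coord N) MeasurableSet.univ] using this

end PairingLimit

theorem sq_norm_pos {z : ℂ} (hz : z ≠ 0) : 0 < ‖z‖ ^ 2 := by positivity

theorem Pairing.act_bijective {n : ℕ} (g : S2 n) :
    Function.Bijective fun x : Pairing n => x.act g := by
  refine Function.bijective_iff_has_inverse.2 ⟨fun x => x.act g⁻¹, fun x => ?_, fun x => ?_⟩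
  · change (x.act g).act g⁻¹ = x
    rw [← act_mul, mul_inv_cancel, act_one]
  · change (x.act g⁻¹).act g = x
    rw [← act_mul, inv_mul_cancel, act_one]

theorem Pairing.map_count_withDensity {n : ℕ} (g : S2 n) (w : Pairing n → ℝ≥0∞) :
    (Measure.count.withDensity fun x : Pairing n => w (x.act g)).map (fun x => x.act g)
      = Measure.count.withDensity w := by
  refine Measure.ext_iff_singleton.2 fun y => ?_
  obtain ⟨x, rfl⟩ := (act_bijective g).2 y
  rw [Measure.map_apply (measurable_of_finite _) (measurableSet_singleton _)]
  have : (fun x : Pairing n => x.act g) ⁻¹' {x.act g} = {x} := by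
    ext x'; exact (act_bijective g).1.eq_iff
  simp only [this, count_withDensity_singleton]

/-- Quasi-invariance of the measure `μ_t`, `t = |z|²`: `dμ_t(x · g) = t ^ c(x; g) dμ_t(x)`. -/
theorem PairingLimit.quasiinvariant {z : ℂ} (hz : z ≠ 0) (g : S2inf) :
    ((mu (sq_norm_pos hz)).withDensity fun x => ‖z ^ x.cocycle g‖ₑ ^ 2).map (fun x => x.act g)
      = mu (sq_norm_pos hz) := by
  refine (measure_ext (level g) fun n hn => ?_).symm
  have hg := S2_mono hn (mem_level g)
  have hz' : 0 < ‖z‖ ^ 2 := sq_norm_pos hz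
  let d : Pairing n → ℝ≥0∞ := fun y => ‖z ^ (((y.act ⟨g, hg⟩).cycles : ℤ) - y.cycles)‖ₑ ^ 2
  have hd : (fun x : PairingLimit => ‖z ^ x.cocycle g‖ₑ ^ 2) = fun x => d (x.coord n) := by
    ext1 x; simp only [d, cocycle_eq x g n hg]
  have hmap : ((mu (sq_norm_pos hz)).withDensity fun x => d (x.coord n)).map (coord n)
      = (Pairing.ewens (‖z‖ ^ 2) n).withDensity d := by
    ext S hS
    rw [Measure.map_apply (measurable_coord n) hS, withDensity_apply _ (measurable_coord n hS),
      withDensity_apply _ hS, ← map_coord_mu (sq_norm_pos hz) n,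
      setLIntegral_map hS (measurable_of_finite _) (measurable_coord n)]
  rw [Measure.map_map (measurable_coord n) (measurable_act g), map_coord_mu, hd]
  have hcomp : (coord n ∘ fun x => act x g) = (fun y => Pairing.act y ⟨g, hg⟩) ∘ coord n := by
    ext1 x; exact coord_act x g n hg
  rw [hcomp, ← Measure.map_map (measurable_of_finite _) (measurable_coord n), hmap]
  rw [Pairing.ewens, ← withDensity_mul _ (measurable_of_finite _) (measurable_of_finite _)]
  rw [← Pairing.map_count_withDensity ⟨g, hg⟩]
  congr 2
  ext1 y
  simp only [Pi.mul_apply, d]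
  have h₁ : ∀ k : ℤ, ‖z ^ k‖ₑ ^ 2 = ENNReal.ofReal ((‖z‖ ^ 2) ^ k) := by
    intro k
    rw [← ofReal_norm, ← ENNReal.ofReal_pow (norm_nonneg _), norm_zpow, ← zpow_natCast,
      ← zpow_natCast, ← zpow_mul, ← zpow_mul, mul_comm]
  rw [h₁, ← ENNReal.ofReal_mul (by positivity)]
  congr 1
  rw [zpow_sub₀ hz'.ne', zpow_natCast, zpow_natCast]
  field_simp

theorem isCocycle_zpow {z : ℂ} (hz : z ≠ 0) :
    IsCocycle (PairingLimit.mu (sq_norm_pos hz)) PairingLimit.act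
      (fun x (g : S2inf) => z ^ x.cocycle g) where
  act_one := PairingLimit.act_one
  act_mul := PairingLimit.act_mul
  measurable_act := PairingLimit.measurable_act
  measurable_cocycle g := by
    have : (fun x : PairingLimit => z ^ x.cocycle g)
        = (fun y : Pairing (level g) => z ^ (((y.act ⟨g, mem_level g⟩).cycles : ℤ) - y.cycles)) ∘
          PairingLimit.coord (level g) := rfl
    rw [this]
    exact (measurable_of_finite _).comp (PairingLimit.measurable_coord _)
  cocycle_ne_zero x g := zpow_ne_zero _ hz
  cocycle_mul x g₁ g₂ := by rw [PairingLimit.cocycle_mul, zpow_add₀ hz]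
  map_eq := PairingLimit.quasiinvariant hz

/-- The representation `T_{z,1/2}` of `S(2∞)` in the Hilbert space `L²(X, μ_t)`, `t = |z|²`:
`(T_{z,1/2}(g) f)(x) = z ^ c(x; g) f(x · g)`. -/
def Tz {z : ℂ} (hz : z ≠ 0) : UnitaryRep S2inf (Lp ℂ 2 (PairingLimit.mu (sq_norm_pos hz))) :=
  (isCocycle_zpow hz).rep

theorem isCocycle_one (n : ℕ) :
    IsCocycle (Pairing.haar n) Pairing.act (fun _ (_ : S2 n) => 1) where
  act_one := Pairing.act_one
  act_mul := Pairing.act_mul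
  measurable_act _ := measurable_of_finite _
  measurable_cocycle _ := measurable_const
  cocycle_ne_zero _ _ := one_ne_zero
  cocycle_mul _ _ _ := (one_mul 1).symm
  map_eq g := by
    have h := Pairing.map_count_withDensity g (fun _ => 1)
    have h₁ : (fun _ : Pairing n => ‖(1 : ℂ)‖ₑ ^ 2) = 1 := by ext1; simp
    have h₂ : (fun _ : Pairing n => (1 : ℝ≥0∞)) = 1 := rfl
    rw [h₂, withDensity_one] at h
    rw [h₁, withDensity_one, Pairing.haar, Measure.map_smul, h]

/-- The Hilbert space `L²(X(n), μ_1^{(n)})`. -/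
abbrev L2 (n : ℕ) : Type := Lp ℂ 2 (Pairing.haar n)

/-- The representation `Reg^n` of `S(2n)` in `L²(X(n), μ_1^{(n)})`: `(Reg^n(g) f)(x) = f(x · g)`. -/
def Reg (n : ℕ) : UnitaryRep (S2 n) (L2 n) := (isCocycle_one n).rep

instance : Nonempty (Pairing 0) := ⟨Pairing.empty⟩

theorem Pairing.nonempty (n : ℕ) : Nonempty (Pairing n) := by
  induction n with
  | zero => infer_instance
  | succ n ih => exact ih.map extend

theorem Pairing.ae_haar {n : ℕ} {p : Pairing n → Prop} : (∀ᵐ x ∂haar n, p x) ↔ ∀ x, p x := by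
  have := Measure.ae_ennreal_smul_measure_iff (μ := (Measure.count : Measure (Pairing n))) (p := p)
    (ENNReal.inv_ne_zero.2 (ENNReal.natCast_ne_top (Nat.card (Pairing n))))
  rwa [Measure.ae_count_iff] at this

instance (n : ℕ) : IsFiniteMeasure (Pairing.haar n) := by
  have := Pairing.nonempty n
  refine ⟨?_⟩
  rw [Pairing.haar, Measure.smul_apply, smul_eq_mul]
  exact ENNReal.mul_lt_top (by simp) (measure_lt_top _ _)

open Classical in
/-- The formula for `L_z^{(n)} f`, with `t = |z|²`: its value at `x` is
`z √((2n+1)/(2n+t)) f(x)` if `x ∈ X(n) ⊆ X(n+1)`, and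
`√((2n+1)/(2n+t)) f(p_{n,n+1}(x))` if `x ∈ X(n+1) ∖ X(n)`. In the first case, `x` is obtained from
an element of `X(n)` by adding the pair `{-n-1, n+1}`, and this element is `x.proj`
(see `Pairing.proj_extend`). -/
def LzFun (z : ℂ) (n : ℕ) (f : Pairing n → ℂ) (x : Pairing (n + 1)) : ℂ :=
  if x ∈ Set.range Pairing.extend then
    z * (√((2 * n + 1) / (2 * n + ‖z‖ ^ 2)) : ℝ) * f x.proj
  else (√((2 * n + 1) / (2 * n + ‖z‖ ^ 2)) : ℝ) * f x.proj

/-- The operator `L_z^{(n)} : L²(X(n), μ_1^{(n)}) → L²(X(n+1), μ_1^{(n+1)})`. -/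
def Lz (z : ℂ) (n : ℕ) : L2 n →ₗ[ℂ] L2 (n + 1) where
  toFun f := (MemLp.of_discrete : MemLp (LzFun z n f) 2 (Pairing.haar (n + 1))).toLp _
  map_add' f₁ f₂ := by
    have h := Pairing.ae_haar.1 (Lp.coeFn_add f₁ f₂)
    rw [← MemLp.toLp_add]
    congr 1
    ext1 x
    simp only [LzFun, Pi.add_apply, h]
    split_ifs <;> ring
  map_smul' c f := by
    have h := Pairing.ae_haar.1 (Lp.coeFn_smul c f)
    rw [RingHom.id_apply, ← MemLp.toLp_const_smul]
    congr 1
    ext1 x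
    simp only [LzFun, Pi.smul_apply, h, smul_eq_mul]
    split_ifs <;> ring

theorem Lz_apply (z : ℂ) (n : ℕ) (f : L2 n) (x : Pairing (n + 1)) :
    Lz z n f x = LzFun z n f x :=
  Pairing.ae_haar.1
    (MemLp.coeFn_toLp (MemLp.of_discrete : MemLp (LzFun z n f) 2 (Pairing.haar (n + 1)))) x

end

/-!
Let `ρₙ` be the root of the density of `μ_1^{(n)}` with respect to `μ_t^{(n)}` which carries the
phase of `z ^ (-[x]_n)`. Then `f ↦ ρₙ(p_n(x)) f(p_n(x))` is an isometry of `L²(X(n), μ_1^{(n)})`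
into `L²(X, μ_t)`. Since `[x]_{n+1} - [p_{n,n+1}(x)]_n` is `1` on `X(n)` and `0` off it, these
isometries are compatible with the operators `L_z^{(n)}`; since `ρₙ(x) = z ^ c(x; g) ρₙ(x · g)`,
they carry `Reg^n` to `T_{z,1/2}`. So `L_z^{(n)}` is isometric and intertwining because its
composition with an isometry is, and as `ρₙ` has no zeros, the images exhaust the cylinder
functions, which are dense.
-/

noncomputable section

namespace IndLim

section Lift

variable {H : ℕ → Type} [∀ n, NormedAddCommGroup (H n)] [∀ n, InnerProductSpace ℂ (H n)]
  {α : ∀ n, H n →ₗᵢ[ℂ] H (n + 1)}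

section UnionLift

variable {K : Type*} [NormedAddCommGroup K] [InnerProductSpace ℂ K] {V : ∀ n, H n →ₗᵢ[ℂ] K}
  (hV : ∀ n ξ, V (n + 1) (α n ξ) = V n ξ)

include hV in
theorem compatible_trans {m n : ℕ} (h : m ≤ n) (ξ : H m) : V n (trans α m n h ξ) = V m ξ := by
  induction n, h using Nat.le_induction with
  | base => rw [trans_self]
  | succ n h ih => rw [trans_succ α m n h, hV, ih]

/-- The linear map `⋃ₙ H n → K` which restricts to the isometries `V n`, given that these are
compatible with the embeddings `α`. -/
def unionLift : UnionSpace α →ₗ[ℂ] K where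
  toFun := DirectLimit.lift (fun i j h => trans α i j h) (fun n ξ => V n ξ)
    fun _ _ h ξ => (compatible_trans hV h ξ).symm
  map_add' x y := by
    obtain ⟨n, ξ, η, rfl, rfl⟩ := exists_incl₂ α x y
    rw [← map_add]
    exact map_add (V n) ξ η
  map_smul' c x := by
    obtain ⟨n, ξ, rfl⟩ := exists_incl α x
    rw [← map_smul]
    exact map_smul (V n) c ξ

theorem unionLift_incl (n : ℕ) (ξ : H n) : unionLift hV (incl α n ξ) = V n ξ :=
  rfl

theorem norm_unionLift (x : UnionSpace α) : ‖unionLift hV x‖ = ‖x‖ := by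
  obtain ⟨n, ξ, rfl⟩ := exists_incl α x
  rw [unionLift_incl, norm_incl, LinearIsometry.norm_map]

theorem denseRange_unionLift (hd : (⨆ n, (V n).range).topologicalClosure = ⊤) :
    DenseRange (unionLift hV) := by
  refine (Submodule.dense_iff_topologicalClosure_eq_top.2 hd).mono ?_
  have hle : ⨆ n, (V n).range ≤ (unionLift hV).range := by
    refine iSup_le fun n => ?_
    rintro _ ⟨ξ, rfl⟩
    exact ⟨incl α n ξ, unionLift_incl hV n ξ⟩
  exact hle

variable [CompleteSpace K]

/-- The Hilbert space isomorphism of the inductive limit with the space `K` in which the images of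
the compatible isometries `V n` span a dense subspace. -/
def equivOfDense (hd : (⨆ n, (V n).range).topologicalClosure = ⊤) :
    Space α ≃ₗᵢ[ℂ] K :=
  (LinearEquiv.refl ℂ (UnionSpace α)).extendOfIsometry
    (UniformSpace.Completion.toComplₗᵢ (𝕜 := ℂ)).toLinearMap (unionLift hV)
    UniformSpace.Completion.denseRange_coe (denseRange_unionLift hV hd)
    fun x => (norm_unionLift hV x).trans (UniformSpace.Completion.norm_coe x).symm

theorem equivOfDense_embed (hd : (⨆ n, (V n).range).topologicalClosure = ⊤)
    (n : ℕ) (ξ : H n) : equivOfDense hV hd (embed α n ξ) = V n ξ :=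
  LinearEquiv.extendOfIsometry_eq _ _ _ _ _ _ (incl α n ξ)

end UnionLift

theorem rep_equivalent {K : Type} [NormedAddCommGroup K] [InnerProductSpace ℂ K] [CompleteSpace K]
    {Γ : Type} [Group Γ] {G : ℕ → Subgroup Γ} (hG : Monotone G) (T : ∀ n, UnitaryRep (G n) (H n))
    (hT : ∀ (n : ℕ) (g : G n) (ξ : H n),
      α n (T n g ξ) = T (n + 1) (Subgroup.inclusion (hG n.le_succ) g) (α n ξ))
    (S : UnitaryRep (⨆ n, G n : Subgroup Γ) K) {V : ∀ n, H n →ₗᵢ[ℂ] K}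
    (hV : ∀ n ξ, V (n + 1) (α n ξ) = V n ξ)
    (hS : ∀ (n : ℕ) (g : (⨆ n, G n : Subgroup Γ)) (h : (g : Γ) ∈ G n) (ξ : H n),
      V n (T n ⟨g, h⟩ ξ) = S g (V n ξ))
    (hd : (⨆ n, (V n).range).topologicalClosure = ⊤) :
    UnitaryRep.Equivalent (rep α hG T hT) S := by
  refine ⟨equivOfDense hV hd, fun g => congrFun (Continuous.ext_on (dense_embed α)
    ((equivOfDense hV hd).continuous.comp (rep α hG T hT g).continuous)
    ((S g).continuous.comp (equivOfDense hV hd).continuous) ?_)⟩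
  rintro _ ⟨n, ξ, rfl⟩
  obtain ⟨N, hN⟩ := exists_stage hG g
  have hmax : (g : Γ) ∈ G (max n N) := hG (le_max_right n N) hN
  change equivOfDense hV hd (rep α hG T hT g (embed α n ξ)) = S g (equivOfDense hV hd (embed α n ξ))
  rw [← embed_trans α (le_max_left n N) ξ, rep_embed α hG T hT g _ hmax, equivOfDense_embed,
    equivOfDense_embed, hS]

end Lift

end IndLim

section CylinderFunctions

theorem isSetAlgebra_iUnion_measurableSet {X ι : Type*} [Nonempty ι] {m : ι → MeasurableSpace X}
    (hm : Directed (· ≤ ·) m) : IsSetAlgebra (⋃ i, {A | MeasurableSet[m i] A}) where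
  empty_mem := Set.mem_iUnion.2 ⟨Classical.arbitrary ι, @MeasurableSet.empty X (m _)⟩
  compl_mem A hA := by
    obtain ⟨i, hi⟩ := Set.mem_iUnion.1 hA
    exact Set.mem_iUnion.2 ⟨i, MeasurableSet.compl hi⟩
  union_mem A B hA hB := by
    obtain ⟨i, hi⟩ := Set.mem_iUnion.1 hA
    obtain ⟨j, hj⟩ := Set.mem_iUnion.1 hB
    obtain ⟨k, hik, hjk⟩ := hm i j
    exact Set.mem_iUnion.2 ⟨k, MeasurableSet.union (hik A hi) (hjk B hj)⟩

variable {X : Type*} [mX : MeasurableSpace X] {μ : Measure X} {E 𝕜 : Type*}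
  [NormedAddCommGroup E] [NormedRing 𝕜] [Module 𝕜 E] [IsBoundedSMul 𝕜 E]
  {p : ℝ≥0∞} [Fact (1 ≤ p)]

theorem topologicalClosure_eq_top_of_indicatorConstLp_mem (hp : p ≠ ∞) {𝒜 : Set (Set X)}
    (h𝒜 : μ.MeasureDense 𝒜) {M : Submodule 𝕜 (Lp E p μ)}
    (hM : ∀ (A : Set X) (hA : A ∈ 𝒜) (hμA : μ A ≠ ∞) (c : E),
      indicatorConstLp p (h𝒜.measurable A hA) hμA c ∈ M) :
    M.topologicalClosure = ⊤ := by
  have : Fact (p ≠ ∞) := ⟨hp⟩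
  refine eq_top_iff.2 fun f _ =>
    Lp.induction hp (fun f => f ∈ M.topologicalClosure) ?_ ?_ M.isClosed_topologicalClosure f
  · intro c A hA hμA
    rw [Lp.simpleFunc.coe_indicatorConst]
    refine closure_mono ?_ (h𝒜.indicatorConstLp_subset_closure p c ⟨A, hA, hμA.ne, rfl⟩)
    rintro _ ⟨B, hB, hμB, rfl⟩
    exact hM B hB hμB c
  · intro f g hf hg _ hfM hgM
    exact add_mem hfM hgM

theorem iSup_range_compMeasurePreserving_topologicalClosure [IsFiniteMeasure μ] (hp : p ≠ ∞)
    {ι : Type*} [Nonempty ι] {Y : ι → Type*} [mY : ∀ i, MeasurableSpace (Y i)]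
    {ν : ∀ i, Measure (Y i)} {φ : ∀ i, X → Y i} (hφ : ∀ i, MeasurePreserving (φ i) μ (ν i))
    (hdir : Directed (· ≤ ·) fun i => (mY i).comap (φ i)) (hgen : ⨆ i, (mY i).comap (φ i) = mX) :
    (⨆ i, (Lp.compMeasurePreservingₗᵢ 𝕜 (E := E) (p := p) (φ i) (hφ i)).range).topologicalClosure
      = ⊤ := by
  have hdense : μ.MeasureDense (⋃ i, {A | MeasurableSet[(mY i).comap (φ i)] A}) :=
    .of_generateFrom_isSetAlgebra_finite _ (isSetAlgebra_iUnion_measurableSet hdir)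
      (hgen.symm.trans (MeasurableSpace.generateFrom_iUnion_measurableSet _).symm)
  refine topologicalClosure_eq_top_of_indicatorConstLp_mem hp hdense fun A hA hμA c => ?_
  obtain ⟨i, S, hS, rfl⟩ := Set.mem_iUnion.1 hA
  have hνS : ν i S ≠ ∞ := by rwa [← (hφ i).measure_preimage hS.nullMeasurableSet]
  exact Submodule.mem_iSup_of_mem i
    ⟨indicatorConstLp p hS hνS c, Lp.indicatorConstLp_compMeasurePreserving hS hνS c (hφ i)⟩

end CylinderFunctions

section DensitySMul

variable {Y : Type*} [MeasurableSpace Y] {κ ν : Measure Y} {E 𝕜 : Type*} [NormedField 𝕜]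
  [NormedAddCommGroup E] [NormedSpace 𝕜 E] {p : ℝ≥0∞} {w : Y → 𝕜} (hw : StronglyMeasurable w)

variable (hν : κ.withDensity (fun y => ‖w y‖ₑ ^ p.toReal) = ν)
include hw hν

theorem absolutelyContinuous_of_withDensity_enorm (hw₀ : ∀ y, w y ≠ 0) : κ ≪ ν :=
  hν ▸ withDensity_absolutelyContinuous' (hw.enorm.pow_const _).aemeasurable (ae_of_all _ fun y =>
    (ENNReal.rpow_pos (enorm_pos.2 (hw₀ y)) enorm_ne_top).ne')

theorem eLpNorm_smul_of_withDensity_enorm (hp₀ : p ≠ 0) (hp : p ≠ ∞) (f : Y → E) :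
    eLpNorm (w • f) p κ = eLpNorm f p ν := by
  have hfinite : ∀ᵐ y ∂κ, ‖w y‖ₑ ^ p.toReal < ∞ :=
    ae_of_all _ fun y => ENNReal.rpow_lt_top_of_nonneg p.toReal_nonneg enorm_ne_top
  rw [← hν, eLpNorm_eq_lintegral_rpow_enorm_toReal hp₀ hp,
    eLpNorm_eq_lintegral_rpow_enorm_toReal hp₀ hp,
    lintegral_withDensity_eq_lintegral_mul_non_measurable _ (hw.enorm.pow_const _) hfinite]
  simp only [Pi.mul_apply, Pi.smul_apply', enorm_smul,
    ENNReal.mul_rpow_of_nonneg _ _ p.toReal_nonneg]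

theorem memLp_smul_iff_of_withDensity_enorm (hw₀ : ∀ y, w y ≠ 0) (hp₀ : p ≠ 0) (hp : p ≠ ∞)
    {f : Y → E} : MemLp (w • f) p κ ↔ MemLp f p ν := by
  rw [MemLp, MemLp, eLpNorm_smul_of_withDensity_enorm hw hν hp₀ hp]
  refine and_congr_left fun _ => (aestronglyMeasurable_smul_iff₀ hw.aestronglyMeasurable
    (ae_of_all _ hw₀)).trans ⟨fun h => h.mono_ac (hν ▸ withDensity_absolutelyContinuous _ _),
      fun h => h.mono_ac (absolutelyContinuous_of_withDensity_enorm hw hν hw₀)⟩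

variable [hp₁ : Fact (1 ≤ p)] (hw₀ : ∀ y, w y ≠ 0) (hp : p ≠ ∞)
include hw₀ hp

theorem memLp_smul_coeFn (f : Lp E p ν) : MemLp (w • ⇑f) p κ :=
  (memLp_smul_iff_of_withDensity_enorm hw hν hw₀ (zero_lt_one.trans_le hp₁.out).ne' hp).2
    (Lp.memLp f)

/-- The isometry `f ↦ w • f` from `L^p` of the measure `ν` with density `|w|^p` with respect to `κ`
to `L^p(κ)`. The description of `ν` is a hypothesis, so that measures which are only propositionally
of this form are allowed. -/
def densitySMul : Lp E p ν →ₗᵢ[𝕜] Lp E p κ where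
  toFun f := (memLp_smul_coeFn hw hν hw₀ hp f).toLp _
  map_add' f g := by
    rw [← MemLp.toLp_add]
    refine MemLp.toLp_congr _ _ ?_
    filter_upwards [(absolutelyContinuous_of_withDensity_enorm hw hν hw₀).ae_eq (Lp.coeFn_add f g)]
      with y hy
    simp only [Pi.smul_apply', Pi.add_apply, hy, smul_add]
  map_smul' c f := by
    rw [RingHom.id_apply, ← MemLp.toLp_const_smul]
    refine MemLp.toLp_congr _ _ ?_
    filter_upwards [(absolutelyContinuous_of_withDensity_enorm hw hν hw₀).ae_eq (Lp.coeFn_smul c f)]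
      with y hy
    simp only [Pi.smul_apply', Pi.smul_apply, hy, smul_comm c]
  norm_map' f := by
    change ‖(memLp_smul_coeFn hw hν hw₀ hp f).toLp _‖ = _
    rw [Lp.norm_toLp, Lp.norm_def,
      eLpNorm_smul_of_withDensity_enorm hw hν (zero_lt_one.trans_le hp₁.out).ne' hp]

theorem coeFn_densitySMul (f : Lp E p ν) : densitySMul hw hν hw₀ hp f =ᵐ[κ] w • ⇑f :=
  (memLp_smul_coeFn hw hν hw₀ hp f).coeFn_toLp

theorem surjective_densitySMul : Function.Surjective (densitySMul (E := E) hw hν hw₀ hp) := by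
  intro g
  have hcancel : w • (w⁻¹ • ⇑g) = g := funext fun y => smul_inv_smul₀ (hw₀ y) (g y)
  have hmem : MemLp (w⁻¹ • ⇑g) p ν := by
    rw [← memLp_smul_iff_of_withDensity_enorm hw hν hw₀ (zero_lt_one.trans_le hp₁.out).ne' hp,
      hcancel]
    exact Lp.memLp g
  refine ⟨hmem.toLp _, Lp.ext ?_⟩
  filter_upwards [coeFn_densitySMul hw hν hw₀ hp (hmem.toLp _),
    (absolutelyContinuous_of_withDensity_enorm hw hν hw₀).ae_eq hmem.coeFn_toLp] with y hy hy'
  rw [hy, Pi.smul_apply', hy', ← Pi.smul_apply', hcancel]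

end DensitySMul

namespace Pairing

variable {n : ℕ} {z : ℂ}

theorem ewens_one (n : ℕ) : ewens 1 n = haar n := by
  have hconst : ewens 1 n
      = ENNReal.ofReal (1 / ∏ k ∈ Finset.range n, ((1 : ℝ) + 2 * k)) • Measure.count := by
    rw [ewens]
    simp only [one_pow]
    exact withDensity_const _
  have huniv : ewens 1 n Set.univ = 1 := by
    rw [← PairingLimit.map_coord_mu one_pos n,
      Measure.map_apply (PairingLimit.measurable_coord n) MeasurableSet.univ, Set.preimage_univ,
      measure_univ]
  rw [hconst, Measure.smul_apply, smul_eq_mul, Measure.count_univ] at huniv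
  rw [hconst, haar, ENNReal.eq_inv_of_mul_eq_one_left huniv, ENat.card_eq_coe_natCard]
  rfl

theorem ewens_withDensity {s t : ℝ} (hs : 0 < s) (ht : 0 < t) (n : ℕ) :
    (ewens t n).withDensity (fun x => ENNReal.ofReal
      ((∏ k ∈ Finset.range n, (t + 2 * k) / (s + 2 * k)) * (s / t) ^ x.cycles)) = ewens s n := by
  rw [ewens, ewens, ← withDensity_mul _ (measurable_of_finite _) (measurable_of_finite _)]
  congr 1
  ext1 x
  have htprod : ∏ k ∈ Finset.range n, (t + 2 * (k : ℝ)) ≠ 0 :=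
    Finset.prod_ne_zero_iff.2 fun k _ => by positivity
  rw [Pi.mul_apply, ← ENNReal.ofReal_mul (div_nonneg (by positivity)
    (Finset.prod_nonneg fun k _ => by positivity)), Finset.prod_div_distrib, div_pow]
  congr 1
  field_simp

/-- A square root of the density of `μ_1^{(n)}` with respect to `μ_t^{(n)}`, `t = |z|²`. Of the two
factors of the density, the function `t ^ (-[x]_n)` has `z ^ (-[x]_n)` as its root, and it is this
choice of the argument that turns the trivial cocycle of `Reg^n` into `z ^ c(x; g)`. -/
def rootDensity (z : ℂ) (x : Pairing n) : ℂ :=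
  (√(∏ k ∈ Finset.range n, (‖z‖ ^ 2 + 2 * k) / (1 + 2 * k)) : ℝ) * (z ^ x.cycles)⁻¹

theorem rootDensity_ne_zero (hz : z ≠ 0) (x : Pairing n) : rootDensity z x ≠ 0 := by
  refine mul_ne_zero (Complex.ofReal_ne_zero.2 (Real.sqrt_pos.2 ?_).ne')
    (inv_ne_zero (pow_ne_zero _ hz))
  exact Finset.prod_pos fun k _ => by positivity

theorem sq_norm_rootDensity (z : ℂ) (x : Pairing n) :
    ‖rootDensity z x‖ ^ 2
      = (∏ k ∈ Finset.range n, (‖z‖ ^ 2 + 2 * k) / (1 + 2 * k)) * (1 / ‖z‖ ^ 2) ^ x.cycles := by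
  rw [rootDensity, norm_mul, mul_pow, Complex.norm_real, Real.norm_eq_abs, sq_abs,
    Real.sq_sqrt (Finset.prod_nonneg fun k _ => by positivity), norm_inv, norm_pow, one_div,
    inv_pow, inv_pow, pow_right_comm]

theorem ewens_withDensity_rootDensity (hz : z ≠ 0) (n : ℕ) :
    (ewens (‖z‖ ^ 2) n).withDensity (fun x => ‖rootDensity z x‖ₑ ^ (2 : ℝ≥0∞).toReal) = haar n := by
  rw [← ewens_one, ← ewens_withDensity one_pos (sq_norm_pos hz)]
  simp only [← sq_norm_rootDensity, ENNReal.ofReal_pow (norm_nonneg _), ofReal_norm,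
    ENNReal.toReal_ofNat, ENNReal.rpow_ofNat]

theorem rootDensity_eq_zpow_mul (hz : z ≠ 0) (x y : Pairing n) :
    rootDensity z x = z ^ ((y.cycles : ℤ) - x.cycles) * rootDensity z y := by
  have := pow_ne_zero y.cycles hz
  rw [rootDensity, rootDensity, zpow_sub₀ hz, zpow_natCast, zpow_natCast]
  field_simp

theorem mem_range_extend_iff (x : Pairing (n + 1)) :
    x ∈ Set.range extend ↔ x.partner (n + 1) = -(n + 1) := by
  rw [← code_eq_none_iff]
  constructor
  · rintro ⟨y, rfl⟩
    exact code_insert y none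
  · intro hcode
    have hinsert := insert_proj_code x
    rw [hcode] at hinsert
    exact ⟨x.proj, hinsert⟩

theorem sqrt_prod_range_succ_mul_sqrt {t : ℝ} (ht : 0 < t) (n : ℕ) :
    √(∏ k ∈ Finset.range (n + 1), (t + 2 * k) / (1 + 2 * k)) * √((2 * n + 1) / (2 * n + t))
      = √(∏ k ∈ Finset.range n, (t + 2 * k) / (1 + 2 * k)) := by
  rw [← Real.sqrt_mul (Finset.prod_nonneg fun k _ => by positivity), Finset.prod_range_succ,
    mul_assoc, add_comm (2 * (n : ℝ)) t, add_comm (2 * (n : ℝ)) 1,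
    div_mul_div_cancel₀ (by positivity), div_self (by positivity), mul_one]

theorem rootDensity_mul_LzFun (hz : z ≠ 0) (f : Pairing n → ℂ) (x : Pairing (n + 1)) :
    rootDensity z x * LzFun z n f x = rootDensity z x.proj * f x.proj := by
  rw [rootDensity, rootDensity, ← sqrt_prod_range_succ_mul_sqrt (sq_norm_pos hz) n, LzFun,
    cycles_proj x, Complex.ofReal_mul]
  simp only [mem_range_extend_iff]
  split_ifs
  · rw [pow_succ]
    field_simp
    ring
  · rw [add_zero]
    ring

end Pairing

theorem Reg_apply {n : ℕ} (g : S2 n) (f : L2 n) (x : Pairing n) : Reg n g f x = f (x.act g) :=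
  (Pairing.ae_haar.1 ((isCocycle_one n).coeFn_rep g f) x).trans (one_mul _)

namespace PairingLimit

theorem measurePreserving_coord {t : ℝ} (ht : 0 < t) (n : ℕ) :
    MeasurePreserving (coord n) (mu ht) (Pairing.ewens t n) :=
  ⟨measurable_coord n, map_coord_mu ht n⟩

theorem comap_coord_mono :
    Monotone fun n => MeasurableSpace.comap (coord n) inferInstance := by
  intro m n h
  refine Measurable.comap_le ?_
  have hcoord : coord m = down h ∘ coord n := funext fun x => (down_coord h x).symm
  rw [hcoord]
  exact (measurable_of_finite _).comp (comap_measurable _)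

theorem iSup_comap_coord :
    ⨆ n, MeasurableSpace.comap (coord n) inferInstance
      = (inferInstance : MeasurableSpace PairingLimit) := by
  change _ = MeasurableSpace.comap Subtype.val
    (⨆ n, MeasurableSpace.comap (fun x : ∀ n, Pairing n => x n) inferInstance)
  simp only [MeasurableSpace.comap_iSup, MeasurableSpace.comap_comp]
  rfl

variable {z : ℂ} (hz : z ≠ 0)

/-- The isometric embedding `L²(X(n), μ_1^{(n)}) → L²(X, μ_t)`, `t = |z|²`, given by
multiplication by the root of the density followed by composition with `p_n`. -/
def coordEmbedding (n : ℕ) : L2 n →ₗᵢ[ℂ] Lp ℂ 2 (mu (sq_norm_pos hz)) :=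
  (Lp.compMeasurePreservingₗᵢ ℂ (coord n) (measurePreserving_coord (sq_norm_pos hz) n)).comp
    (densitySMul (measurable_of_finite _).stronglyMeasurable
      (Pairing.ewens_withDensity_rootDensity hz n) (Pairing.rootDensity_ne_zero hz)
      ENNReal.ofNat_ne_top)

theorem coeFn_coordEmbedding (n : ℕ) (f : L2 n) :
    coordEmbedding hz n f =ᵐ[mu (sq_norm_pos hz)]
      fun x => (x.coord n).rootDensity z * f (x.coord n) :=
  (Lp.coeFn_compMeasurePreserving _ (measurePreserving_coord _ n)).trans <|
    (measurePreserving_coord _ n).quasiMeasurePreserving.ae_eq_comp <|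
      coeFn_densitySMul _ (Pairing.ewens_withDensity_rootDensity hz n) _ _ f

theorem coordEmbedding_Lz (n : ℕ) (f : L2 n) :
    coordEmbedding hz (n + 1) (Lz z n f) = coordEmbedding hz n f := by
  refine Lp.ext ?_
  filter_upwards [coeFn_coordEmbedding hz n f, coeFn_coordEmbedding hz (n + 1) (Lz z n f)]
    with x hf hLf
  rw [hf, hLf, Lz_apply, Pairing.rootDensity_mul_LzFun hz, proj_coord]

theorem coordEmbedding_Reg (n : ℕ) (g : S2inf) (hg : (g : (Equiv.Perm ℤ)ᵐᵒᵖ) ∈ S2 n) (f : L2 n) :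
    coordEmbedding hz n (Reg n ⟨g, hg⟩ f) = Tz hz g (coordEmbedding hz n f) := by
  refine Lp.ext ?_
  filter_upwards [coeFn_coordEmbedding hz n (Reg n ⟨g, hg⟩ f),
    (isCocycle_zpow hz).coeFn_rep g (coordEmbedding hz n f),
    ((isCocycle_zpow hz).quasi g).ae (coeFn_coordEmbedding hz n f)] with x hx hTx hxg
  rw [hx, Tz, hTx, hxg, Reg_apply, coord_act x g n hg, cocycle_eq x g n hg,
    Pairing.rootDensity_eq_zpow_mul hz (x.coord n) ((x.coord n).act ⟨g, hg⟩), mul_assoc]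

theorem range_coordEmbedding (n : ℕ) :
    (coordEmbedding hz n).range = (Lp.compMeasurePreservingₗᵢ ℂ (E := ℂ) (p := 2) (coord n)
      (measurePreserving_coord (sq_norm_pos hz) n)).range :=
  LinearMap.range_comp_of_range_eq_top _ (LinearMap.range_eq_top.2 (surjective_densitySMul _ _ _ _))

theorem iSup_range_coordEmbedding_topologicalClosure :
    (⨆ n, (coordEmbedding hz (n + 1)).range).topologicalClosure = ⊤ := by
  simp only [range_coordEmbedding]
  exact iSup_range_compMeasurePreserving_topologicalClosure ENNReal.ofNat_ne_top _
    (comap_coord_mono.comp (add_left_mono (a := 1))).directed_le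
    ((comap_coord_mono.iSup_nat_add 1).trans iSup_comap_coord)

end PairingLimit

section Lz

variable {z : ℂ} (hz : z ≠ 0) (n : ℕ)
include hz

theorem norm_Lz (f : L2 n) : ‖Lz z n f‖ = ‖f‖ := by
  rw [← (PairingLimit.coordEmbedding hz (n + 1)).norm_map, PairingLimit.coordEmbedding_Lz,
    LinearIsometry.norm_map]

theorem Lz_Reg (g : S2 n) (f : L2 n) :
    Lz z n (Reg n g f) = Reg (n + 1) (Subgroup.inclusion (S2_mono n.le_succ) g) (Lz z n f) := by
  have hg : (g : (Equiv.Perm ℤ)ᵐᵒᵖ) ∈ S2 (n + 1) := S2_mono n.le_succ g.2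
  let γ : S2inf := ⟨g, le_iSup (fun n => S2 (n + 1)) n hg⟩
  apply (PairingLimit.coordEmbedding hz (n + 1)).injective
  calc PairingLimit.coordEmbedding hz (n + 1) (Lz z n (Reg n g f))
      = PairingLimit.coordEmbedding hz n (Reg n g f) := PairingLimit.coordEmbedding_Lz hz n _
    _ = Tz hz γ (PairingLimit.coordEmbedding hz n f) :=
        PairingLimit.coordEmbedding_Reg hz n γ g.2 f
    _ = Tz hz γ (PairingLimit.coordEmbedding hz (n + 1) (Lz z n f)) := by
        rw [PairingLimit.coordEmbedding_Lz]
    _ = PairingLimit.coordEmbedding hz (n + 1) (Reg (n + 1) ⟨g, hg⟩ (Lz z n f)) :=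
        (PairingLimit.coordEmbedding_Reg hz (n + 1) γ hg _).symm

end Lz

end

theorem mainTheorem6 (z : ℂ) (hz : z ≠ 0) :
    ∃ (isometric : ∀ (n : ℕ) (f : L2 (n + 1)), ‖Lz z (n + 1) f‖ = ‖f‖)
      (intertwines : ∀ (n : ℕ) (g : S2 (n + 1)) (f : L2 (n + 1)),
        Lz z (n + 1) (Reg (n + 1) g f)
          = Reg (n + 2) (Subgroup.inclusion (S2_succ_mono n.le_succ) g) (Lz z (n + 1) f)),
      UnitaryRep.Equivalent
        (IndLim.rep (fun n => (⟨Lz z (n + 1), isometric n⟩ : L2 (n + 1) →ₗᵢ[ℂ] L2 (n + 2)))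
          S2_succ_mono (fun n => Reg (n + 1)) intertwines)
        (Tz hz) := by
  refine ⟨fun n => norm_Lz hz (n + 1), fun n => Lz_Reg hz (n + 1), ?_⟩
  exact IndLim.rep_equivalent S2_succ_mono _ _ (Tz hz)
    (fun n => PairingLimit.coordEmbedding_Lz hz (n + 1))
    (fun n => PairingLimit.coordEmbedding_Reg hz (n + 1))
    (PairingLimit.iSup_range_coordEmbedding_topologicalClosure hz)
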